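/- Let $k$ be a number field with ring of integers $\mathcal{O}_k$, let $n \ge 0$ and let $\mathbf{a} = (a_0,\dots,a_n)$ be a tuple of positive integers. The unit group $\mathcal{O}_k^\times$ acts on $\mathcal{O}_k^{n+1}$ by $u\cdot(x_0,\dots,x_n) = (u^{a_0}x_0,\dots,u^{a_n}x_n)$; write $\mathcal{O}_k^{n+1}/\mathcal{O}_k^\times$ for the set of orbits. For $\mathbf{x}\in\mathcal{O}_k^{n+1}$ put $$H_{\mathbf{a},\infty}(\mathbf{x}) = \prod_{v\mid\infty}\max_{0\le i\le n}|x_i|_v^{1/a_i},$$ where $|\cdot|_v$ is the normalised absolute value (the square of the usual one if $v$ is complex); this depends only on the orbit of $\mathbf{x}$. For every constant $c>0$ there is a constant $C>0$, depending only on $k$, $\mathbf{a}$ and $c$, such that the following holds. Let $Q\ge 1$ and $B>0$ be real numbers, let $m\ge 1$ be an integer, and for every nonzero prime ideal $\mathfrak{p}$ of $\mathcal{O}_k$ let $\Omega_{\mathfrak{p}^m}\subseteq(\mathcal{O}_k/\mathfrak{p}^m)^{n+1}$ be an arbitrary set of residue classes, with $\nu(\Omega_{\mathfrak{p}^m}) =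 \#\Omega_{\mathfrak{p}^m}/\#(\mathcal{O}_k/\mathfrak{p}^m)^{n+1}$. Then the number of orbits $[\mathbf{x}]\in\mathcal{O}_k^{n+1}/\mathcal{O}_k^\times$ such that $H_{\mathbf{a},\infty}(\mathbf{x})\le cB$ and such that no representative of the orbit reduces modulo $\mathfrak{p}^m$ into $\Omega_{\mathfrak{p}^m}$, for any $\mathfrak{p}$ with $N_{k/\mathbb{Q}}(\mathfrak{p})\le Q$, is finite and at most $$C\,\frac{\prod_{i=0}^n\left(B^{a_i}+Q^{2m}\right)}{G(Q)},\qquad G(Q)=\sum_{N_{k/\mathbb{Q}}(\mathfrak{q})\le Q}\mu_k(\mathfrak{q})^2\prod_{\mathfrak{p}\mid\mathfrak{q}}\frac{\nu(\Omega_{\mathfrak{p}^m})}{1-\nu(\Omega_{\mathfrak{p}^m})},$$ where the sum is over the nonzero ideals $\mathfrak{q}$ of $\mathcal{O}_k$ and $\mu_k$ is the Möbius function of ideals. If $\nu(\Omega_{\mathfrak{p}^m})=1$ for some $\mathfrak{p}$ with $N_{k/\mathbb{Q}}(\mathfrak{p})\le Q$, then $G(Q)=\infty$ and the bound is read as $0$.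 (If every $\Omega_{\mathfrak{p}^m}$ is stable under the action of $\mathcal{O}_k^\times$, the sieve condition may be tested on any one representative of the orbit.) -/

import Mathlib

open NumberField IsDedekindDomain
open scoped ENNReal

namespace LopsidedSieve

variable (k : Type*) [Field k] [NumberField k] {n : ℕ}

/-- The orbit relation of the weighted action of the units of `𝓞 k` on `(𝓞 k)^(n+1)`:
a unit `u` sends `(x₀, …, xₙ)` to `(u ^ a₀ * x₀, …, u ^ aₙ * xₙ)`. -/
def unitSetoid (a : Fin (n + 1) → ℕ+) : Setoid (Fin (n + 1) → 𝓞 k) where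
  r x y := ∃ u : (𝓞 k)ˣ, ∀ i, y i = (u : 𝓞 k) ^ (a i : ℕ) * x i
  iseqv :=
    { refl := fun x => ⟨1, fun i => by simp⟩
      symm := by
        rintro x y ⟨u, hu⟩
        refine ⟨u⁻¹, fun i => ?_⟩
        rw [hu i, ← mul_assoc, ← mul_pow, Units.inv_mul, one_pow, one_mul]
      trans := by
        rintro x y z ⟨u, hu⟩ ⟨w, hw⟩
        refine ⟨w * u, fun i => ?_⟩
        rw [hw i, hu i, Units.val_mul, mul_pow, mul_assoc] }

/-- The infinite part `H_{a,∞}(x) = ∏_{v ∣ ∞} max_i |x_i|_v ^ (1 / a_i)` of the weighted height.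
Here `|z|_v` is the normalised absolute value, that is, the usual one at a real place and its
square at a complex place (`v.mult` is the local degree). -/
noncomputable def heightInfty (a : Fin (n + 1) → ℕ+) (x : Fin (n + 1) → 𝓞 k) : ℝ :=
  ∏ v : InfinitePlace k, ⨆ i, (v (x i : k) ^ v.mult) ^ (1 / ((a i : ℕ) : ℝ))

/-- The infinite part of the weighted height is constant on orbits. -/
theorem heightInfty_eq_of_rel (a : Fin (n + 1) → ℕ+) (x y : Fin (n + 1) → 𝓞 k)
    (h : (unitSetoid k a).r x y) : heightInfty k a x = heightInfty k a y := by
  obtain ⟨u, hu⟩ := h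
  have key : ∀ v : InfinitePlace k,
      (⨆ i, (v (y i : k) ^ v.mult) ^ (1 / ((a i : ℕ) : ℝ))) =
        v ((u : 𝓞 k) : k) ^ v.mult * ⨆ i, (v (x i : k) ^ v.mult) ^ (1 / ((a i : ℕ) : ℝ)) := by
    intro v
    have h0 : (0 : ℝ) ≤ v ((u : 𝓞 k) : k) ^ v.mult := pow_nonneg (apply_nonneg v _) _
    rw [Real.mul_iSup_of_nonneg h0]
    congr 1
    funext i
    have e : v (y i : k) ^ v.mult =
        (v ((u : 𝓞 k) : k) ^ v.mult) ^ (a i : ℕ) * v (x i : k) ^ v.mult := by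
      rw [hu i]
      push_cast
      rw [map_mul, map_pow, mul_pow, ← pow_mul, ← pow_mul, mul_comm v.mult]
    rw [e, Real.mul_rpow (pow_nonneg h0 _) (pow_nonneg (apply_nonneg v _) _), one_div,
      Real.pow_rpow_inv_natCast h0 (a i).pos.ne']
  unfold heightInfty
  rw [Finset.prod_congr rfl fun v _ => key v, Finset.prod_mul_distrib,
    InfinitePlace.prod_eq_abs_norm]
  have hnorm : |Algebra.norm ℚ ((u : 𝓞 k) : k)| = 1 :=
    (NumberField.isUnit_iff_norm.mp u.isUnit)
  rw [hnorm]
  simp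

/-- The infinite part of the weighted height as a function on the set of orbits. -/
noncomputable def orbitHeight (a : Fin (n + 1) → ℕ+) : Quotient (unitSetoid k a) → ℝ :=
  Quotient.lift (heightInfty k a) (heightInfty_eq_of_rel k a)

/-- Reduction of a tuple modulo an ideal, coordinate by coordinate. -/
def reduce (I : Ideal (𝓞 k)) (x : Fin (n + 1) → 𝓞 k) : Fin (n + 1) → 𝓞 k ⧸ I :=
  fun i => Ideal.Quotient.mk I (x i)

/-- The orbits of height at most `T` that survive the sieve by the classes `Ω p` modulo `p ^ m`
for the primes `p` of norm at most `Q`: no representative of the orbit reduces into some `Ω p`.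
(If all the `Ω p` are stable under the action of the units, this can be tested on any single
representative.) -/
def siftedOrbits (a : Fin (n + 1) → ℕ+) (m : ℕ)
    (Ω : ∀ p : HeightOneSpectrum (𝓞 k), Set (Fin (n + 1) → 𝓞 k ⧸ p.asIdeal ^ m))
    (Q T : ℝ) : Set (Quotient (unitSetoid k a)) :=
  {ξ | orbitHeight k a ξ ≤ T ∧
    ∀ x : Fin (n + 1) → 𝓞 k, Quotient.mk (unitSetoid k a) x = ξ →
      ∀ p : HeightOneSpectrum (𝓞 k), (Ideal.absNorm p.asIdeal : ℝ) ≤ Q →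
        reduce k (p.asIdeal ^ m) x ∉ Ω p}

/-- The measure `ν(S)` of a set `S` of residue classes in `(𝓞 k / I)^(n+1)` with respect to the
uniform probability measure. -/
noncomputable def uniformMass (I : Ideal (𝓞 k)) (S : Set (Fin (n + 1) → 𝓞 k ⧸ I)) : ℝ≥0∞ :=
  (S.encard : ℝ≥0∞) / (Nat.card (Fin (n + 1) → 𝓞 k ⧸ I) : ℝ≥0∞)

open Classical in
/-- The Möbius function of ideals: `(-1) ^ r` on a product of `r` distinct primes, and `0` on all
other ideals (the zero ideal among them, which is not squarefree). -/
noncomputable def moebius (q : Ideal (𝓞 k)) : ℤ :=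
  if Squarefree q then
    (-1) ^ Multiset.card (UniqueFactorizationMonoid.normalizedFactors q) else 0

/-- `G(Q) = ∑_{N q ≤ Q} μ(q)² ∏_{p ∣ q} ν(Ω p) / (1 - ν(Ω p))`, over the nonzero ideals `q`, with
values in `[0, ∞]`; the fraction is `∞` where `ν(Ω p) = 1`. -/
noncomputable def sieveSum (m : ℕ)
    (Ω : ∀ p : HeightOneSpectrum (𝓞 k), Set (Fin (n + 1) → 𝓞 k ⧸ p.asIdeal ^ m))
    (Q : ℝ) : ℝ≥0∞ :=
  ∑' q : {q : Ideal (𝓞 k) // q ≠ ⊥ ∧ (Ideal.absNorm q : ℝ) ≤ Q},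
    (((moebius k q.1).natAbs ^ 2 : ℕ) : ℝ≥0∞) *
      ∏ᶠ (p : HeightOneSpectrum (𝓞 k)) (_ : p.asIdeal ∣ q.1),
        uniformMass k (p.asIdeal ^ m) (Ω p) / (1 - uniformMass k (p.asIdeal ^ m) (Ω p))

end LopsidedSieve

namespace LopsidedSieve

/-! The proof is a large sieve on boxes, run inside one finite group, after the units have moved
every orbit into a box.

Reduction to a box. By Dirichlet's unit theorem an orbit of height at most `T` has a representative
whose `i`-th entry is `≪ T^(a_i/D)` at every infinite place, where `D = [k : ℚ]`; its coordinates in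
an integral basis satisfy the same bound (`exists_rel_abs_repr_le`). Distinct orbits give distinct
points, and these avoid all the sets `Ω p`.

Arithmetic half. A sum over points that avoid `Ω p` vanishes on the fibres above `Ω p`, so
Cauchy-Schwarz and Parseval force the nontrivial characters modulo `p ^ m` to carry at least
`ν/(1-ν)` times its square. Iterating over the primes dividing a squarefree `q` gives the term of
`G(Q)` at `q` (`prod_mul_card_sq_le`).

Analytic half. The box points embed in `G = (𝓞 k / J)^(n+1)` for a suitable `J`. Let `U` be the
characters of `G` with small angles on the integral basis. They are nearly `1` on the box, and by
pigeonhole `|G|/|U|` is at most of the order of a slightly enlarged box. If the translates by `U` of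
the sieving characters are disjoint, Parseval bounds the total of the squared character sums by `4
|G| |X| / |U|` (`card_mul_sum_norm_sq_le`).

Disjointness. A coincidence of translates produces a character with small angles that is trivial on
an ideal of norm at most `Q^(2m)`. Such an ideal contains a nonzero `α` with small coordinates.
Triviality at the products of `α` with the basis is then an exact linear system for the angles, with
determinant the norm of `α`, so the character is trivial (`exists_forall_addChar_eq_zero`). This is
the source of `Q^(2m)`. -/

/-! ### Arithmetic half of the large sieve on a finite abelian group -/

/-- Parseval's identity on a finite abelian group. -/
theorem sum_norm_sq_sum_mul_addChar {G : Type*} [AddCommGroup G] [Fintype G] (b : G → ℂ) :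
    ∑ ψ : AddChar G ℂ, ‖∑ x, b x * ψ x‖ ^ 2 = Fintype.card G * ∑ x, ‖b x‖ ^ 2 := by
  classical
  have key : ∀ ψ : AddChar G ℂ, ((‖∑ x, b x * ψ x‖ ^ 2 : ℝ) : ℂ) =
      ∑ x, ∑ y, b x * (starRingEnd ℂ) (b y) * ψ (x - y) := by
    intro ψ
    push_cast
    rw [← Complex.mul_conj', map_sum, Finset.sum_mul_sum]
    refine Finset.sum_congr rfl fun x _ => Finset.sum_congr rfl fun y _ => ?_
    rw [map_mul, ← AddChar.map_neg_eq_conj, sub_eq_add_neg, AddChar.map_add_eq_mul]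
    ring
  apply Complex.ofReal_injective
  rw [Complex.ofReal_sum, Finset.sum_congr rfl fun ψ _ => key ψ, Finset.sum_comm]
  push_cast
  rw [Finset.mul_sum]
  refine Finset.sum_congr rfl fun x _ => ?_
  rw [Finset.sum_comm]
  have h2 : ∀ y, ∑ ψ : AddChar G ℂ, b x * (starRingEnd ℂ) (b y) * ψ (x - y) =
      if x = y then Fintype.card G * (‖b x‖ : ℂ) ^ 2 else 0 := by
    intro y
    rw [← Finset.mul_sum, AddChar.sum_apply_eq_ite]
    simp only [sub_eq_zero]
    split_ifs with h
    · subst h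
      rw [Complex.mul_conj']
      ring
    · simp
  rw [Finset.sum_congr rfl fun y _ => h2 y]
  simp

/-- If the points of `X` reduce outside `Ω`, then the nontrivial characters capture a fixed
proportion of the square of any sum over `X`. -/
theorem card_div_mul_norm_sum_sq_le {α R : Type*} [AddCommGroup R] [Fintype R]
    (X : Finset α) (b : α → ℂ) (ρ : α → R) (Ω : Finset R) (hΩ : Ω.card < Fintype.card R)
    (hX : ∀ x ∈ X, ρ x ∉ Ω) :
    (Ω.card : ℝ) / (Fintype.card R - Ω.card) * ‖∑ x ∈ X, b x‖ ^ 2 ≤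
      ∑ φ ∈ (Finset.univ : Finset (AddChar R ℂ)).erase 0, ‖∑ x ∈ X, b x * φ (ρ x)‖ ^ 2 := by
  classical
  -- The fibre sums vanish on `Ω`, so Cauchy-Schwarz costs only `|R| - |Ω|` while Parseval carries
  -- the factor `|R|`; the difference is the gain. The term at the trivial character is the square
  -- on the left.
  set z : R → ℂ := fun r => ∑ x ∈ X with ρ x = r, b x with hz
  have hfib : ∀ g : R → ℂ, ∑ x ∈ X, b x * g (ρ x) = ∑ r, z r * g r := by
    intro g
    rw [← Finset.sum_fiberwise X ρ]
    refine Finset.sum_congr rfl fun r _ => ?_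
    rw [hz, Finset.sum_mul]
    refine Finset.sum_congr rfl fun x hx => ?_
    rw [(Finset.mem_filter.mp hx).2]
  have hsum : ∑ x ∈ X, b x = ∑ r ∈ Ωᶜ, z r := by
    have h1 := hfib fun _ => 1
    simp only [mul_one] at h1
    rw [h1, ← Finset.sum_compl_add_sum Ω]
    rw [Finset.sum_eq_zero (s := Ω), add_zero]
    intro r hr
    rw [hz]
    refine Finset.sum_eq_zero fun x hx => ?_
    rw [Finset.mem_filter] at hx
    exact absurd (hx.2 ▸ hr) (hX x hx.1)
  have hpos : (0 : ℝ) < Fintype.card R - Ω.card := by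
    rw [sub_pos]; exact_mod_cast hΩ
  have hCS : ‖∑ x ∈ X, b x‖ ^ 2 ≤ (Fintype.card R - Ω.card) * ∑ r, ‖z r‖ ^ 2 := by
    calc ‖∑ x ∈ X, b x‖ ^ 2 ≤ (∑ r ∈ Ωᶜ, ‖z r‖) ^ 2 := by
          rw [hsum]; gcongr; exact norm_sum_le _ _
      _ ≤ (Ωᶜ.card : ℝ) * ∑ r ∈ Ωᶜ, ‖z r‖ ^ 2 := sq_sum_le_card_mul_sum_sq
      _ ≤ (Fintype.card R - Ω.card) * ∑ r, ‖z r‖ ^ 2 := by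
          rw [Finset.card_compl, Nat.cast_sub hΩ.le]
          gcongr
          exact Finset.subset_univ _
  have hP := sum_norm_sq_sum_mul_addChar z
  rw [← Finset.add_sum_erase _ _ (Finset.mem_univ (0 : AddChar R ℂ))] at hP
  simp only [← hfib] at hP
  simp only [AddChar.zero_apply, mul_one] at hP
  rw [div_mul_eq_mul_div, div_le_iff₀ hpos]
  have hc : (0 : ℝ) ≤ Fintype.card R := Nat.cast_nonneg _
  nlinarith [mul_le_mul_of_nonneg_left hCS hc]

/-- The character of `G` that a family of characters of quotients of `G` defines. -/
noncomputable def combine {ι G : Type*} [Fintype ι] [AddCommGroup G] {R : ι → Type*}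
    [∀ p, AddCommGroup (R p)] (π : ∀ p, G →+ R p) (f : ∀ p, AddChar (R p) ℂ) : AddChar G ℂ :=
  ∑ p, (f p).compAddMonoidHom (π p)

section Combine

variable {ι G : Type*} [Fintype ι] [AddCommGroup G] {R : ι → Type*}
  [∀ p, AddCommGroup (R p)] (π : ∀ p, G →+ R p)

theorem combine_apply (f : ∀ p, AddChar (R p) ℂ) (x : G) :
    combine π f x = ∏ p, f p (π p x) := by
  simp [combine, AddChar.sum_apply]

theorem combine_zero_apply (x : G) : combine π 0 x = 1 := by
  simp [combine_apply]

theorem combine_add_single [DecidableEq ι] (f : ∀ p, AddChar (R p) ℂ) (p : ι)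
    (φ : AddChar (R p) ℂ) (x : G) :
    combine π (f + Pi.single p φ) x = combine π f x * φ (π p x) := by
  rw [combine_apply, combine_apply]
  simp only [Pi.add_apply, AddChar.add_apply, Finset.prod_mul_distrib]
  congr 1
  rw [Finset.prod_eq_single p]
  · simp
  · intro q _ hq
    simp [Pi.single_eq_of_ne hq]
  · simp

/-- The families of characters that are nontrivial exactly at the indices in `S`. -/
noncomputable def supportedOn [∀ p, Fintype (R p)] (S : Finset ι) :
    Finset (∀ p, AddChar (R p) ℂ) := by
  classical
  exact Finset.univ.filter fun f => ∀ p, f p ≠ 0 ↔ p ∈ S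

theorem mem_supportedOn [∀ p, Fintype (R p)] {S : Finset ι} {f : ∀ p, AddChar (R p) ℂ} :
    f ∈ supportedOn S ↔ ∀ p, f p ≠ 0 ↔ p ∈ S := by
  simp [supportedOn]

/-- Induction on `S`: the one-modulus inequality is applied with weights `combine π f x`, which is
why it allows complex weights. Adding a nontrivial character at the new index maps pairs injectively
into the families supported on the larger set. -/
theorem prod_mul_card_sq_le [∀ p, Fintype (R p)] (X : Finset G) (Ω : ∀ p, Finset (R p))
    (hΩ : ∀ p, (Ω p).card < Fintype.card (R p)) (hX : ∀ x ∈ X, ∀ p, π p x ∉ Ω p) (S : Finset ι) :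
    (∏ p ∈ S, ((Ω p).card : ℝ) / (Fintype.card (R p) - (Ω p).card)) * (X.card : ℝ) ^ 2 ≤
      ∑ f ∈ supportedOn (R := R) S, ‖∑ x ∈ X, combine π f x‖ ^ 2 := by
  classical
  induction S using Finset.induction_on with
  | empty =>
    rw [← Finset.sum_subset (s₁ := {0})]
    · simp [combine_zero_apply]
    · simp [mem_supportedOn]
    · intro f hf hf0
      rw [mem_supportedOn] at hf
      simp only [Finset.notMem_empty, iff_false, not_not] at hf
      exact absurd (Finset.mem_singleton.mpr (funext hf)) hf0
  | insert p S hp ih =>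
    rw [Finset.prod_insert hp, mul_assoc]
    have hg : (0 : ℝ) ≤ ((Ω p).card : ℝ) / (Fintype.card (R p) - (Ω p).card) := by
      apply div_nonneg (Nat.cast_nonneg _)
      rw [sub_nonneg]; exact_mod_cast (hΩ p).le
    refine (mul_le_mul_of_nonneg_left ih hg).trans ?_
    rw [Finset.mul_sum]
    have h1 : ∀ f ∈ supportedOn (R := R) S,
        ((Ω p).card : ℝ) / (Fintype.card (R p) - (Ω p).card) * ‖∑ x ∈ X, combine π f x‖ ^ 2 ≤
        ∑ φ ∈ (Finset.univ : Finset (AddChar (R p) ℂ)).erase 0,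
          ‖∑ x ∈ X, combine π (f + Pi.single p φ) x‖ ^ 2 := by
      intro f _
      simp only [combine_add_single]
      exact card_div_mul_norm_sum_sq_le X _ (fun x => π p x) (Ω p) (hΩ p) fun x hx => hX x hx p
    refine (Finset.sum_le_sum h1).trans ?_
    rw [← Finset.sum_product']
    have hzero : ∀ f ∈ supportedOn (R := R) S, f p = 0 := by
      intro f hf
      by_contra h
      exact hp ((mem_supportedOn.mp hf p).mp h)
    have hinj : Set.InjOn
        (fun y : (∀ p, AddChar (R p) ℂ) × AddChar (R p) ℂ => y.1 + Pi.single p y.2)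
        (supportedOn (R := R) S ×ˢ (Finset.univ : Finset (AddChar (R p) ℂ)).erase 0 :
          Finset ((∀ p, AddChar (R p) ℂ) × AddChar (R p) ℂ)) := by
      rintro ⟨f, φ⟩ hy ⟨f', φ'⟩ hy' h
      simp only [Finset.coe_product, Set.mem_prod, Finset.mem_coe] at hy hy'
      have hφ : φ = φ' := by
        have := congrFun h p
        simpa [hzero f hy.1, hzero f' hy'.1] using this
      subst hφ
      simpa using h
    refine (Finset.sum_image (f := fun f => ‖∑ x ∈ X, combine π f x‖ ^ 2) hinj).symm.le.trans ?_
    refine Finset.sum_le_sum_of_subset_of_nonneg ?_ fun _ _ _ => by positivity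
    intro h hh
    rw [Finset.mem_image] at hh
    obtain ⟨⟨f, φ⟩, hy, rfl⟩ := hh
    rw [Finset.mem_product, Finset.mem_erase] at hy
    rw [mem_supportedOn]
    intro q
    by_cases hq : q = p
    · subst hq
      simpa [hzero f hy.1] using hy.2.1
    · simpa [hq, Pi.single_eq_of_ne hq] using mem_supportedOn.mp hy.1 q

end Combine

/-! ### Analytic half of the large sieve -/

/-- The analytic large sieve inequality on a finite abelian group, for characters whose translates
by a set `U` of characters almost constant on `X` are disjoint. -/
theorem card_mul_sum_norm_sq_le {Φ G : Type*} [AddCommGroup G] [Fintype G] (X : Finset G)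
    (F : Finset Φ) (ψ : Φ → AddChar G ℂ) (U : Finset (AddChar G ℂ))
    (hU : ∀ u ∈ U, ∀ x ∈ X, 1 / 2 ≤ (u x).re) (hne : U.Nonempty)
    (hinj : ∀ f ∈ F, ∀ f' ∈ F, ∀ u ∈ U, ∀ u' ∈ U, ψ f + u = ψ f' + u' → f = f') :
    (U.card : ℝ) * ∑ f ∈ F, ‖∑ x ∈ X, ψ f x‖ ^ 2 ≤ 4 * Fintype.card G * X.card := by
  classical
  have hUpos : (0 : ℝ) < U.card := by exact_mod_cast hne.card_pos
  set g : G → ℂ := fun x => ∑ u ∈ U, u x with hg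
  have hgle : ∀ x ∈ X, (U.card : ℝ) / 2 ≤ ‖g x‖ := by
    intro x hx
    refine le_trans ?_ (Complex.re_le_norm _)
    rw [hg, Complex.re_sum]
    calc (U.card : ℝ) / 2 = ∑ u ∈ U, (1 / 2 : ℝ) := by simp; ring
      _ ≤ _ := Finset.sum_le_sum fun u hu => hU u hu x hx
  have hg0 : ∀ x ∈ X, g x ≠ 0 := by
    intro x hx h
    have := hgle x hx
    rw [h, norm_zero] at this
    linarith
  -- With weights `1/g`, the sum of `ψ f` over `X` becomes the sum of the Fourier transform `T` of
  -- `b` over the translate `ψ f + U`. Disjoint translates then let a single use of Parseval bound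
  -- all `f` together.
  set b : G → ℂ := fun x => if x ∈ X then (g x)⁻¹ else 0 with hb
  set T : AddChar G ℂ → ℂ := fun τ => ∑ x, b x * τ x with hT
  have hST : ∀ f, ∑ x ∈ X, ψ f x = ∑ u ∈ U, T (ψ f + u) := by
    intro f
    rw [hT, Finset.sum_comm, ← Finset.sum_subset (Finset.subset_univ X)]
    · refine Finset.sum_congr rfl fun x hx => ?_
      simp only [AddChar.add_apply, ← mul_assoc, ← Finset.mul_sum]
      rw [hb]
      simp only [hx, if_true]
      change _ = (g x)⁻¹ * _ * g x
      field_simp [hg0 x hx]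
    · intro x _ hx
      simp [hb, hx]
  have h1 : ∀ f ∈ F, ‖∑ x ∈ X, ψ f x‖ ^ 2 ≤ U.card * ∑ u ∈ U, ‖T (ψ f + u)‖ ^ 2 := by
    intro f _
    rw [hST f]
    calc _ ≤ (∑ u ∈ U, ‖T (ψ f + u)‖) ^ 2 := by gcongr; exact norm_sum_le _ _
      _ ≤ _ := sq_sum_le_card_mul_sum_sq
  have h2 : ∑ f ∈ F, ∑ u ∈ U, ‖T (ψ f + u)‖ ^ 2 ≤ ∑ τ, ‖T τ‖ ^ 2 := by
    rw [← Finset.sum_product', ← Finset.sum_image (f := fun τ => ‖T τ‖ ^ 2)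
      (g := fun y : Φ × AddChar G ℂ => ψ y.1 + y.2)]
    · exact Finset.sum_le_sum_of_subset_of_nonneg (Finset.subset_univ _)
        fun _ _ _ => by positivity
    · rintro ⟨f, u⟩ hy ⟨f', u'⟩ hy' h
      simp only [Finset.coe_product, Set.mem_prod, Finset.mem_coe] at hy hy'
      obtain rfl := hinj f hy.1 f' hy'.1 u hy.2 u' hy'.2 h
      simpa using h
  have h3 : ∑ τ, ‖T τ‖ ^ 2 ≤ Fintype.card G * (X.card * (4 / (U.card : ℝ) ^ 2)) := by
    rw [hT, sum_norm_sq_sum_mul_addChar]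
    gcongr
    rw [← Finset.sum_subset (Finset.subset_univ X)]
    · calc ∑ x ∈ X, ‖b x‖ ^ 2 ≤ ∑ x ∈ X, 4 / (U.card : ℝ) ^ 2 := by
            refine Finset.sum_le_sum fun x hx => ?_
            simp only [hb, hx, if_true, norm_inv]
            rw [inv_pow, inv_le_comm₀ (by have := hg0 x hx; positivity) (by positivity)]
            have := hgle x hx
            rw [inv_div, div_le_iff₀ (by norm_num)]
            nlinarith
        _ = _ := by simp
    · intro x _ hx
      simp [hb, hx]
  calc (U.card : ℝ) * ∑ f ∈ F, ‖∑ x ∈ X, ψ f x‖ ^ 2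
      ≤ U.card * (U.card * ∑ f ∈ F, ∑ u ∈ U, ‖T (ψ f + u)‖ ^ 2) := by
        gcongr
        rw [Finset.mul_sum]
        exact Finset.sum_le_sum h1
    _ ≤ U.card * (U.card * (Fintype.card G * (X.card * (4 / (U.card : ℝ) ^ 2)))) := by
        gcongr
        exact h2.trans h3
    _ = 4 * Fintype.card G * X.card := by
        field_simp

/-! ### Characters of `𝓞 k` that are trivial on an ideal -/

/-- The index type of the chosen integral basis. -/
abbrev BasisIndex (k : Type*) [Field k] [NumberField k] : Type _ :=
  Module.Free.ChooseBasisIndex ℤ (𝓞 k)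

section

variable (k : Type*) [Field k] [NumberField k]

theorem card_basisIndex : Fintype.card (BasisIndex k) = Module.finrank ℚ k := by
  rw [← Module.finrank_eq_card_basis (RingOfIntegers.basis k), RingOfIntegers.rank]

variable {k}

/-- A nonzero ideal contains a nonzero element with small coordinates. -/
theorem exists_ne_zero_mem_abs_repr_le (I : Ideal (𝓞 k)) (hI : I ≠ ⊥) (T : ℕ)
    (hT : Ideal.absNorm I < (T + 1) ^ Module.finrank ℚ k) :
    ∃ α ∈ I, α ≠ 0 ∧ ∀ j, |(RingOfIntegers.basis k).repr α j| ≤ T := by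
  classical
  have := Ideal.finiteQuotientOfFreeOfNeBot I hI
  let := Fintype.ofFinite (𝓞 k ⧸ I)
  let F : (BasisIndex k → Fin (T + 1)) → 𝓞 k := fun c =>
    ∑ j, ((c j : ℕ) : ℤ) • RingOfIntegers.basis k j
  have hF : ∀ c j, (RingOfIntegers.basis k).repr (F c) j = ((c j : ℕ) : ℤ) := by
    intro c j
    exact congrFun (Module.Basis.repr_sum_self (RingOfIntegers.basis k)
      (fun j => ((c j : ℕ) : ℤ))) j
  -- Pigeonhole: there are `(T + 1) ^ D` combinations with coefficients in `{0, …, T}`, more than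
  -- the residue classes modulo `I`.
  obtain ⟨c, c', hne, heq⟩ := Fintype.exists_ne_map_eq_of_card_lt
    (fun c => Ideal.Quotient.mk I (F c)) (by
      rw [Fintype.card_fun, Fintype.card_fin, card_basisIndex, ← Nat.card_eq_fintype_card,
        ← Submodule.cardQuot_apply, ← Ideal.absNorm_apply]
      exact hT)
  refine ⟨F c - F c', Ideal.Quotient.eq.mp heq, ?_, fun j => ?_⟩
  · rw [sub_ne_zero]
    intro h
    refine hne (funext fun j => Fin.ext ?_)
    have h1 := hF c j
    rw [h, hF c' j] at h1
    exact_mod_cast h1.symm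
  · rw [map_sub, Finsupp.sub_apply, hF, hF]
    have h1 := (c j).isLt
    have h2 := (c' j).isLt
    rw [abs_le]
    omega

variable (k) in
/-- The coordinates of a product with a basis element are controlled by those of the factor. -/
theorem exists_abs_repr_mul_basis_le : ∃ C : ℝ, 0 < C ∧ ∀ (α : 𝓞 k) (T : ℝ),
    (∀ j, |((RingOfIntegers.basis k).repr α j : ℝ)| ≤ T) →
      ∀ l h, |((RingOfIntegers.basis k).repr (α * RingOfIntegers.basis k l) h : ℝ)| ≤ C * T := by
  set b := RingOfIntegers.basis k with hb
  refine ⟨1 + ∑ j, ∑ l, ∑ h, |(b.repr (b j * b l) h : ℝ)|, by positivity, fun α T hT l h => ?_⟩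
  have hT0 : 0 ≤ T := (abs_nonneg _).trans (hT l)
  have e : (b.repr (α * b l) h : ℝ) = ∑ j, (b.repr α j : ℝ) * (b.repr (b j * b l) h : ℝ) := by
    conv_lhs => rw [← b.sum_repr α, Finset.sum_mul, map_sum]
    simp only [smul_mul_assoc, map_zsmul, Finsupp.coe_finsetSum, Finset.sum_apply,
      Finsupp.coe_smul, Pi.smul_apply, smul_eq_mul, Int.cast_sum, Int.cast_mul]
  rw [e]
  calc _ ≤ ∑ j, |(b.repr α j : ℝ) * (b.repr (b j * b l) h : ℝ)| := Finset.abs_sum_le_sum_abs _ _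
    _ ≤ ∑ j, T * ∑ l, ∑ h, |(b.repr (b j * b l) h : ℝ)| := by
        refine Finset.sum_le_sum fun j _ => ?_
        rw [abs_mul]
        refine mul_le_mul (hT j) ?_ (abs_nonneg _) hT0
        calc _ ≤ ∑ h, |(b.repr (b j * b l) h : ℝ)| := Finset.single_le_sum
              (f := fun h => |(b.repr (b j * b l) h : ℝ)|) (fun _ _ => abs_nonneg _)
              (Finset.mem_univ h)
          _ ≤ _ := Finset.single_le_sum (f := fun l => ∑ h, |(b.repr (b j * b l) h : ℝ)|)
              (fun _ _ => by positivity) (Finset.mem_univ l)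
    _ ≤ _ := by
        rw [← Finset.mul_sum]
        nlinarith

/-- A character is determined by its angles on a basis. -/
theorem addChar_apply_eq_exp {w : AddChar (𝓞 k) ℂ} {θ : BasisIndex k → ℝ}
    (hw : ∀ j, w (RingOfIntegers.basis k j) = Complex.exp (θ j * Complex.I)) (x : 𝓞 k) :
    w x = Complex.exp
      ((∑ j, ((RingOfIntegers.basis k).repr x j : ℝ) * θ j : ℝ) * Complex.I) := by
  conv_lhs => rw [← (RingOfIntegers.basis k).sum_repr x]
  have h1 : ∀ (s : Finset (BasisIndex k)) (g : BasisIndex k → 𝓞 k),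
      w (∑ j ∈ s, g j) = ∏ j ∈ s, w (g j) := by
    classical
    intro s g
    induction s using Finset.induction_on with
    | empty => simp
    | insert a s ha ih => rw [Finset.sum_insert ha, AddChar.map_add_eq_mul, ih,
        Finset.prod_insert ha]
  rw [h1]
  push_cast
  rw [Finset.sum_mul, Complex.exp_sum]
  refine Finset.prod_congr rfl fun j _ => ?_
  rw [AddChar.map_zsmul_eq_zpow, hw, ← Complex.exp_int_mul]
  congr 1
  ring

theorem eq_zero_of_exp_eq_one {x : ℝ} (hx : |x| < 2 * Real.pi)
    (h : Complex.exp (x * Complex.I) = 1) : x = 0 := by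
  obtain ⟨n, hn⟩ := Complex.exp_eq_one_iff.mp h
  have h1 : x = n * (2 * Real.pi) := by
    have h2 : (x : ℂ) * Complex.I = ((n * (2 * Real.pi) : ℝ) : ℂ) * Complex.I := by
      rw [hn]; push_cast; ring
    exact_mod_cast mul_right_cancel₀ Complex.I_ne_zero h2
  have hpi := Real.pi_pos
  have h3 : |(n : ℝ)| < 1 := by
    rw [h1, abs_mul, abs_of_pos (by positivity : 0 < 2 * Real.pi)] at hx
    by_contra! h4
    nlinarith
  have h5 : n = 0 := by
    rw [← Int.abs_lt_one_iff]
    exact_mod_cast h3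
  rw [h1, h5]
  simp

variable (k) in
/-- A character that is trivial on an ideal and close to `1` on a basis is trivial. -/
theorem exists_forall_addChar_eq_zero : ∃ C : ℝ, 0 < C ∧
    ∀ (I : Ideal (𝓞 k)) (Y : ℝ), I ≠ ⊥ → 0 ≤ Y → (Ideal.absNorm I : ℝ) ≤ Y ^ Module.finrank ℚ k →
      ∀ (w : AddChar (𝓞 k) ℂ) (θ : BasisIndex k → ℝ),
        (∀ j, w (RingOfIntegers.basis k j) = Complex.exp (θ j * Complex.I)) →
        (∀ x ∈ I, w x = 1) → (∀ j, |θ j| * (C * Y) ≤ 1) → w = 0 := by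
  classical
  obtain ⟨C, hC, hmul⟩ := exists_abs_repr_mul_basis_le k
  set b := RingOfIntegers.basis k with hb
  -- This factor makes each of the `D` terms of the phase at `α * b l` at most `1 / (D + 1)`, so the
  -- phase stays below `2 * π` and must vanish exactly.
  refine ⟨(Fintype.card (BasisIndex k) + 1) * C, by positivity,
    fun I Y hI hY hIY w θ hw hwI hθ => ?_⟩
  have hD : Module.finrank ℚ k ≠ 0 := Module.finrank_pos.ne'
  obtain ⟨α, hαI, hα0, hα⟩ := exists_ne_zero_mem_abs_repr_le I hI ⌊Y⌋₊ (by
    have h1 : (Ideal.absNorm I : ℝ) < ((⌊Y⌋₊ : ℝ) + 1) ^ Module.finrank ℚ k :=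
      hIY.trans_lt (pow_lt_pow_left₀ (Nat.lt_floor_add_one Y) hY hD)
    exact_mod_cast h1)
  have hα' : ∀ j, |(b.repr α j : ℝ)| ≤ Y := fun j =>
    le_trans (by exact_mod_cast hα j) (Nat.floor_le hY)
  have hlin : ∀ l, ∑ h, (b.repr (α * b l) h : ℝ) * θ h = 0 := by
    intro l
    refine eq_zero_of_exp_eq_one ?_ ?_
    · calc _ ≤ ∑ h, |(b.repr (α * b l) h : ℝ) * θ h| := Finset.abs_sum_le_sum_abs _ _
        _ ≤ ∑ h : BasisIndex k, 1 / ((Fintype.card (BasisIndex k) : ℝ) + 1) := by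
            refine Finset.sum_le_sum fun h _ => ?_
            rw [abs_mul, le_div_iff₀ (by positivity)]
            have h1 := hmul α Y hα' l h
            have h2 := hθ h
            have h3 := mul_le_mul_of_nonneg_right h1 (abs_nonneg (θ h))
            have h4 := mul_le_mul_of_nonneg_right h3
              (by positivity : (0 : ℝ) ≤ (Fintype.card (BasisIndex k) : ℝ) + 1)
            linarith
        _ ≤ 1 := by
            rw [Finset.sum_const, nsmul_eq_mul, Finset.card_univ, mul_one_div,
              div_le_one (by positivity)]
            linarith
        _ < 2 * Real.pi := by linarith [Real.pi_gt_three]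
    · rw [← addChar_apply_eq_exp hw]
      exact hwI _ (I.mul_mem_right _ hαI)
  -- By `hlin`, `θ` is killed by the transposed matrix of multiplication by `α`, which is
  -- nonsingular because its determinant is the norm of `α`.
  have hθ0 : θ = 0 := by
    refine Matrix.eq_zero_of_mulVec_eq_zero
      (M := ((Algebra.leftMulMatrix b α).map (Int.castRingHom ℝ)).transpose) ?_ ?_
    · rw [Matrix.det_transpose, ← RingHom.mapMatrix_apply, ← RingHom.map_det,
        ← Algebra.norm_eq_matrix_det b]
      simpa using (Algebra.norm_ne_zero_iff (R := ℤ)).mpr hα0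
    · funext l
      simp only [Matrix.mulVec, dotProduct, Matrix.transpose_apply, Matrix.map_apply,
        Algebra.leftMulMatrix_eq_repr_mul, Pi.zero_apply]
      simpa using hlin l
  rw [AddChar.eq_zero_iff]
  intro x
  rw [addChar_apply_eq_exp hw, hθ0]
  simp

end

/-! ### Small characters of tuples and their number -/

section Tuples

variable {k : Type*} [Field k] [NumberField k] {n : ℕ}

/-- The restriction of a character of tuples modulo `J` to the `i`-th coordinate. -/
noncomputable def coordChar {J : Ideal (𝓞 k)} (v : AddChar (Fin (n + 1) → 𝓞 k ⧸ J) ℂ)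
    (i : Fin (n + 1)) : AddChar (𝓞 k) ℂ :=
  v.compAddMonoidHom ((AddMonoidHom.single (fun _ : Fin (n + 1) => 𝓞 k ⧸ J) i).comp
    (Ideal.Quotient.mk J).toAddMonoidHom)

omit [NumberField k] in
theorem coordChar_apply {J : Ideal (𝓞 k)} (v : AddChar (Fin (n + 1) → 𝓞 k ⧸ J) ℂ)
    (i : Fin (n + 1)) (y : 𝓞 k) :
    coordChar v i y = v (reduce k J (Pi.single i y)) := by
  change v (Pi.single i (Ideal.Quotient.mk J y)) = _
  congr 1
  funext j
  by_cases h : j = i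
  · subst h; simp [reduce]
  · simp [reduce, Pi.single_eq_of_ne h]

omit [NumberField k] in
theorem apply_reduce_eq_prod_coordChar {J : Ideal (𝓞 k)}
    (v : AddChar (Fin (n + 1) → 𝓞 k ⧸ J) ℂ) (x : Fin (n + 1) → 𝓞 k) :
    v (reduce k J x) = ∏ i, coordChar v i (x i) := by
  have h1 : ∀ (s : Finset (Fin (n + 1))) (g : Fin (n + 1) → Fin (n + 1) → 𝓞 k ⧸ J),
      v (∑ j ∈ s, g j) = ∏ j ∈ s, v (g j) := by
    intro s g
    induction s using Finset.induction_on with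
    | empty => simp
    | insert a s ha ih => rw [Finset.sum_insert ha, AddChar.map_add_eq_mul, ih,
        Finset.prod_insert ha]
  rw [← Finset.univ_sum_single (reduce k J x), h1]
  rfl

/-- The characters of tuples modulo `J` whose angles on the `i`-th copy of the integral basis are
at most `2 * π / K i`. -/
noncomputable def smallChars (J : Ideal (𝓞 k)) [Fintype (𝓞 k ⧸ J)] (K : Fin (n + 1) → ℕ) :
    Finset (AddChar (Fin (n + 1) → 𝓞 k ⧸ J) ℂ) := by
  classical
  exact Finset.univ.filter fun u => ∃ θ : Fin (n + 1) → BasisIndex k → ℝ,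
    (∀ i j, |θ i j| ≤ 2 * Real.pi / K i) ∧
      ∀ i j, coordChar u i (RingOfIntegers.basis k j) = Complex.exp (θ i j * Complex.I)

theorem mem_smallChars {J : Ideal (𝓞 k)} [Fintype (𝓞 k ⧸ J)] {K : Fin (n + 1) → ℕ}
    {u : AddChar (Fin (n + 1) → 𝓞 k ⧸ J) ℂ} :
    u ∈ smallChars J K ↔ ∃ θ : Fin (n + 1) → BasisIndex k → ℝ,
      (∀ i j, |θ i j| ≤ 2 * Real.pi / K i) ∧
        ∀ i j, coordChar u i (RingOfIntegers.basis k j) = Complex.exp (θ i j * Complex.I) := by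
  simp [smallChars]

theorem zero_mem_smallChars (J : Ideal (𝓞 k)) [Fintype (𝓞 k ⧸ J)] (K : Fin (n + 1) → ℕ) :
    (0 : AddChar (Fin (n + 1) → 𝓞 k ⧸ J) ℂ) ∈ smallChars J K := by
  rw [mem_smallChars]
  refine ⟨0, fun i j => ?_, fun i j => ?_⟩
  · have := Real.pi_pos
    simp only [Pi.zero_apply, abs_zero]
    positivity
  · simp [coordChar_apply]

/-- By the pigeonhole principle on angles, there are many small characters. -/
theorem card_le_card_smallChars_mul (J : Ideal (𝓞 k)) [Fintype (𝓞 k ⧸ J)]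
    (K : Fin (n + 1) → ℕ) (hK : ∀ i, 0 < K i) :
    Fintype.card (Fin (n + 1) → 𝓞 k ⧸ J) ≤
      (smallChars J K).card * ∏ i, (K i + 1) ^ Module.finrank ℚ k := by
  classical
  rw [← AddChar.card_eq]
  have hpi := Real.pi_pos
  let ang : AddChar (Fin (n + 1) → 𝓞 k ⧸ J) ℂ → Fin (n + 1) → BasisIndex k → ℝ := fun u i j =>
    Complex.arg (coordChar u i (RingOfIntegers.basis k j))
  have hexp : ∀ u i j, coordChar u i (RingOfIntegers.basis k j) =
      Complex.exp (ang u i j * Complex.I) := by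
    intro u i j
    have h1 := Complex.norm_mul_exp_arg_mul_I (coordChar u i (RingOfIntegers.basis k j))
    have h2 : ‖coordChar u i (RingOfIntegers.basis k j)‖ = 1 := by
      rw [coordChar_apply]; exact AddChar.norm_apply _ _
    rw [h2, Complex.ofReal_one, one_mul] at h1
    exact h1.symm
  have hfrac : ∀ u i j, 0 ≤ K i * (ang u i j / (2 * Real.pi) + 1 / 2) ∧
      K i * (ang u i j / (2 * Real.pi) + 1 / 2) ≤ K i := by
    intro u i j
    have h1 : -Real.pi < ang u i j := Complex.neg_pi_lt_arg _
    have h2 : ang u i j ≤ Real.pi := Complex.arg_le_pi _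
    have h3 : -(1 / 2) ≤ ang u i j / (2 * Real.pi) := by
      rw [le_div_iff₀ (by positivity)]; linarith
    have h4 : ang u i j / (2 * Real.pi) ≤ 1 / 2 := by
      rw [div_le_iff₀ (by positivity)]; linarith
    constructor
    · apply mul_nonneg (Nat.cast_nonneg _); linarith
    · apply mul_le_of_le_one_right (Nat.cast_nonneg _); linarith
  -- The floor takes `K i + 1` values, since the argument `π` lands on `K i` itself.
  let cell : AddChar (Fin (n + 1) → 𝓞 k ⧸ J) ℂ → Fin (n + 1) → BasisIndex k → ℕ := fun u i j =>
    ⌊(K i : ℝ) * (ang u i j / (2 * Real.pi) + 1 / 2)⌋₊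
  have hcells : ∏ i, (K i + 1) ^ Module.finrank ℚ k = (Fintype.piFinset fun i : Fin (n + 1) =>
      Fintype.piFinset fun _ : BasisIndex k => Finset.range (K i + 1)).card := by
    simp [Fintype.card_piFinset, card_basisIndex]
  rw [hcells, ← Finset.card_univ]
  refine Finset.card_le_mul_card_image_of_maps_to (f := cell) ?_ _ ?_
  · intro u _
    simp only [Fintype.mem_piFinset, Finset.mem_range, Nat.lt_succ_iff]
    intro i j
    exact Nat.floor_le_of_le (hfrac u i j).2
  · intro g _
    rcases Finset.eq_empty_or_nonempty (Finset.univ.filter fun u => cell u = g) with h | ⟨u₀, hu₀⟩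
    · rw [h]; simp
    -- Subtracting one fixed member of the cell turns the others into characters with angles at most
    -- `2 * π / K i`.
    · refine Finset.card_le_card_of_injOn (fun u => u - u₀) ?_ ?_
      · intro u hu
        simp only [Finset.coe_filter, Finset.mem_univ, true_and, Set.mem_ofPred_eq] at hu
        simp only [Finset.mem_filter, Finset.mem_univ, true_and] at hu₀
        rw [Finset.mem_coe, mem_smallChars]
        refine ⟨fun i j => ang u i j - ang u₀ i j, fun i j => ?_, fun i j => ?_⟩
        · have hc : cell u i j = cell u₀ i j := by rw [hu, hu₀]
          have hKi : (0 : ℝ) < K i := by exact_mod_cast hK i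
          have a1 := Nat.floor_le (hfrac u i j).1
          have a2 := Nat.lt_floor_add_one ((K i : ℝ) * (ang u i j / (2 * Real.pi) + 1 / 2))
          have b1 := Nat.floor_le (hfrac u₀ i j).1
          have b2 := Nat.lt_floor_add_one ((K i : ℝ) * (ang u₀ i j / (2 * Real.pi) + 1 / 2))
          change (cell u i j : ℝ) ≤ _ at a1
          change _ < (cell u i j : ℝ) + 1 at a2
          change (cell u₀ i j : ℝ) ≤ _ at b1
          change _ < (cell u₀ i j : ℝ) + 1 at b2
          rw [hc] at a1 a2
          have key : |K i * ((ang u i j - ang u₀ i j) / (2 * Real.pi))| ≤ 1 := by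
            rw [sub_div, abs_le]
            constructor <;> nlinarith
          rw [abs_mul, abs_div, abs_of_pos hKi, abs_of_pos (by positivity : 0 < 2 * Real.pi),
            mul_div_assoc', div_le_one (by positivity)] at key
          rw [le_div_iff₀ hKi]
          linarith
        · have h1 := hexp u i j
          have h2 := hexp u₀ i j
          rw [coordChar_apply] at h1 h2 ⊢
          rw [AddChar.sub_apply, AddChar.map_neg_eq_inv, h1, h2, ← Complex.exp_neg,
            ← Complex.exp_add]
          congr 1
          push_cast
          ring
      · intro u _ u' _ h
        simpa using h

end Tuples

/-! ### The large sieve for boxes in `(𝓞 k)^(n+1)` -/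

section

universe u

variable {k : Type u} [Field k] [NumberField k] {n : ℕ}

theorem not_isUnit_two : ¬ IsUnit (2 : 𝓞 k) := by
  intro h
  have h1 := h.map (Algebra.norm ℤ)
  have h2 : Algebra.norm ℤ (2 : 𝓞 k) = 2 ^ Module.finrank ℤ (𝓞 k) := by
    simpa using Algebra.norm_algebraMap (S := 𝓞 k) (2 : ℤ)
  rw [h2, RingOfIntegers.rank, isUnit_pow_iff Module.finrank_pos.ne'] at h1
  revert h1
  decide

/-- A finite set of tuples is separated by some nonzero ideal inside a given one. -/
theorem exists_ideal_le_injOn_reduce (X : Finset (Fin (n + 1) → 𝓞 k)) (I : Ideal (𝓞 k))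
    (hI : I ≠ ⊥) : ∃ J : Ideal (𝓞 k), J ≠ ⊥ ∧ J ≤ I ∧
      Set.InjOn (reduce k J) (X : Set (Fin (n + 1) → 𝓞 k)) := by
  classical
  let s := ((X ×ˢ X) ×ˢ (Finset.univ : Finset (Fin (n + 1)))).filter
    fun z => z.1.1 z.2 ≠ z.1.2 z.2
  let d : 𝓞 k := ∏ z ∈ s, (z.1.1 z.2 - z.1.2 z.2)
  have hd : d ≠ 0 := by
    refine Finset.prod_ne_zero_iff.mpr fun z hz => ?_
    exact sub_ne_zero.mpr (Finset.mem_filter.mp hz).2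
  -- The factor `2` matters: `d` may be a unit, but `2 * d` never divides `d`, whereas every nonzero
  -- coordinate difference does.
  refine ⟨I * Ideal.span {2 * d}, ?_, Ideal.mul_le_left, ?_⟩
  · refine mul_ne_zero hI ?_
    rw [Ne, Ideal.zero_eq_bot, Ideal.span_singleton_eq_bot]
    exact mul_ne_zero two_ne_zero hd
  · intro x hx y hy h
    by_contra hne
    obtain ⟨i, hi⟩ := Function.ne_iff.mp hne
    have h1 : x i - y i ∈ Ideal.span {2 * d} :=
      Ideal.mul_le_right (Ideal.Quotient.eq.mp (congrFun h i))
    rw [Ideal.mem_span_singleton] at h1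
    have hs : ((x, y), i) ∈ s := Finset.mem_filter.mpr
      ⟨Finset.mem_product.mpr ⟨Finset.mem_product.mpr ⟨hx, hy⟩, Finset.mem_univ i⟩, hi⟩
    have h2 : x i - y i ∣ d := Finset.dvd_prod_of_mem _ hs
    have h3 : 2 * d ∣ 1 * d := by simpa using h1.trans h2
    exact not_isUnit_two (isUnit_of_dvd_one ((mul_dvd_mul_iff_right hd).mp h3))

/-- The reduction of tuples modulo `J` to tuples modulo a larger ideal. -/
def reduceHom {I J : Ideal (𝓞 k)} (h : J ≤ I) :
    (Fin (n + 1) → 𝓞 k ⧸ J) →+ (Fin (n + 1) → 𝓞 k ⧸ I) :=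
  (Ideal.Quotient.factor h).toAddMonoidHom.compLeft (Fin (n + 1))

omit [NumberField k] in
theorem reduceHom_reduce {I J : Ideal (𝓞 k)} (h : J ≤ I) (x : Fin (n + 1) → 𝓞 k) :
    reduceHom h (reduce k J x) = reduce k I x := rfl

omit [NumberField k] in
theorem reduce_surjective (I : Ideal (𝓞 k)) :
    Function.Surjective (reduce k I : (Fin (n + 1) → 𝓞 k) → _) := by
  intro r
  choose x hx using fun i => Ideal.Quotient.mk_surjective (r i)
  exact ⟨x, funext hx⟩

omit [NumberField k] in
theorem reduce_eq_zero {I : Ideal (𝓞 k)} {x : Fin (n + 1) → 𝓞 k} (hx : ∀ i, x i ∈ I) :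
    reduce k I x = 0 :=
  funext fun i => Ideal.Quotient.eq_zero_iff_mem.mpr (hx i)

omit [NumberField k] in
/-- Characters of pairwise coprime moduli are independent. -/
theorem combine_reduceHom_injective {ι : Type*} [Fintype ι] {I : ι → Ideal (𝓞 k)}
    (hcop : Pairwise (Function.onFun IsCoprime I)) {J : Ideal (𝓞 k)} (hJ : ∀ p, J ≤ I p) :
    Function.Injective (combine fun p => reduceHom (n := n) (hJ p)) := by
  classical
  intro f f' h
  funext p
  ext r
  obtain ⟨y, rfl⟩ := reduce_surjective (I p) r
  -- The Chinese remainder theorem supplies a tuple congruent to `y` modulo `I p` and to `0` modulo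
  -- the other moduli, which isolates the factor at `p`.
  choose x hx using fun i : Fin (n + 1) =>
    Ideal.exists_forall_sub_mem_ideal hcop (fun q => if q = p then y i else 0)
  have hp : reduce k (I p) x = reduce k (I p) y := by
    funext i
    refine Ideal.Quotient.eq.mpr ?_
    simpa using hx i p
  have hq : ∀ q, q ≠ p → reduce k (I q) x = 0 := by
    intro q hq
    refine reduce_eq_zero fun i => ?_
    simpa [hq] using hx i q
  have h1 := DFunLike.congr_fun h (reduce k J x)
  simp only [combine_apply, reduceHom_reduce] at h1
  rw [Finset.prod_eq_single p, Finset.prod_eq_single p, hp] at h1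
  · exact h1
  · intro q _ hqp
    rw [hq q hqp, AddChar.map_zero_eq_one]
  · simp
  · intro q _ hqp
    rw [hq q hqp, AddChar.map_zero_eq_one]
  · simp

-- Factors at indices in `S` see the residue `0`, and the others are trivial characters. Hence the
-- difference of two combined characters is trivial on the product of the two ideals, the input to
-- the spacing argument.
omit [NumberField k] in
theorem combine_reduce_eq_one {ι : Type*} [Fintype ι] {I : ι → Ideal (𝓞 k)}
    [∀ p, Fintype (Fin (n + 1) → 𝓞 k ⧸ I p)] {J : Ideal (𝓞 k)} (hJ : ∀ p, J ≤ I p) {S : Finset ι}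
    {f : ∀ p, AddChar (Fin (n + 1) → 𝓞 k ⧸ I p) ℂ} (hf : f ∈ supportedOn S)
    {x : Fin (n + 1) → 𝓞 k} (hx : ∀ i, x i ∈ ∏ p ∈ S, I p) :
    combine (fun p => reduceHom (hJ p)) f (reduce k J x) = 1 := by
  rw [combine_apply]
  refine Finset.prod_eq_one fun p _ => ?_
  by_cases hp : p ∈ S
  · rw [reduceHom_reduce,
      reduce_eq_zero fun i => Ideal.le_of_dvd (Finset.dvd_prod_of_mem I hp) (hx i),
      AddChar.map_zero_eq_one]
  · have h0 : f p = 0 := by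
      by_contra h
      exact hp ((mem_supportedOn.mp hf p).mp h)
    rw [h0, AddChar.zero_apply]

/-- Small characters are almost constant on boxes. -/
theorem half_le_re_of_mem_smallChars {J : Ideal (𝓞 k)} [Fintype (𝓞 k ⧸ J)] {K : Fin (n + 1) → ℕ}
    {u : AddChar (Fin (n + 1) → 𝓞 k ⧸ J) ℂ} (hu : u ∈ smallChars J K) {R : Fin (n + 1) → ℝ}
    (hR : ∀ i, 2 * Real.pi * (n + 1) * Module.finrank ℚ k * R i ≤ K i) (hK : ∀ i, 0 < K i)
    {x : Fin (n + 1) → 𝓞 k} (hx : ∀ i j, |((RingOfIntegers.basis k).repr (x i) j : ℝ)| ≤ R i) :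
    1 / 2 ≤ (u (reduce k J x)).re := by
  obtain ⟨θ, hθ, hu⟩ := mem_smallChars.mp hu
  have hpi := Real.pi_pos
  have hD : (0 : ℝ) < Module.finrank ℚ k := by exact_mod_cast Module.finrank_pos
  have e : u (reduce k J x) = Complex.exp
      ((∑ i, ∑ j, ((RingOfIntegers.basis k).repr (x i) j : ℝ) * θ i j : ℝ) * Complex.I) := by
    rw [apply_reduce_eq_prod_coordChar, Complex.ofReal_sum, Finset.sum_mul, Complex.exp_sum]
    exact Finset.prod_congr rfl fun i _ => addChar_apply_eq_exp (hu i) (x i)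
  rw [e, Complex.exp_ofReal_mul_I_re]
  refine le_trans ?_ Real.one_sub_sq_div_two_le_cos
  -- The phase has `(n + 1) * D` terms, and `hR` makes each at most the reciprocal of that number;
  -- then `cos s ≥ 1 - s ^ 2 / 2 ≥ 1 / 2`.
  have h1 : |∑ i, ∑ j, ((RingOfIntegers.basis k).repr (x i) j : ℝ) * θ i j| ≤ 1 := by
    calc _ ≤ ∑ i : Fin (n + 1), ∑ j : BasisIndex k,
          (1 / ((n + 1) * Module.finrank ℚ k) : ℝ) := by
          refine (Finset.abs_sum_le_sum_abs _ _).trans (Finset.sum_le_sum fun i _ => ?_)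
          refine (Finset.abs_sum_le_sum_abs _ _).trans (Finset.sum_le_sum fun j _ => ?_)
          have hKi : (0 : ℝ) < K i := by exact_mod_cast hK i
          have hRi : 0 ≤ R i := (abs_nonneg _).trans (hx i j)
          rw [abs_mul, le_div_iff₀ (by positivity)]
          calc _ ≤ R i * (2 * Real.pi / K i) * ((n + 1) * Module.finrank ℚ k) := by
                gcongr
                · exact hx i j
                · exact hθ i j
            _ = (2 * Real.pi * (n + 1) * Module.finrank ℚ k * R i) / K i := by ring
            _ ≤ 1 := by rw [div_le_one hKi]; exact hR i
      _ = 1 := by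
          simp only [Finset.sum_const, Finset.card_univ, card_basisIndex, Fintype.card_fin,
            nsmul_eq_mul]
          push_cast
          field_simp
  have h2 := abs_le.mp h1
  nlinarith

/-- The characters attached to the sieving moduli are well spaced: their translates by the small
characters are disjoint. -/
theorem eq_of_combine_add_eq {ι : Type*} [Fintype ι] {I : ι → Ideal (𝓞 k)}
    [∀ p, Fintype (Fin (n + 1) → 𝓞 k ⧸ I p)]
    (hcop : Pairwise (Function.onFun IsCoprime I)) {J : Ideal (𝓞 k)} [Fintype (𝓞 k ⧸ J)]
    (hJ : ∀ p, J ≤ I p) {S S' : Finset ι} {f f' : ∀ p, AddChar (Fin (n + 1) → 𝓞 k ⧸ I p) ℂ}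
    (hf : f ∈ supportedOn S) (hf' : f' ∈ supportedOn S') {C : ℝ}
    (htriv : ∀ (w : AddChar (𝓞 k) ℂ) (θ : BasisIndex k → ℝ),
      (∀ j, w (RingOfIntegers.basis k j) = Complex.exp (θ j * Complex.I)) →
      (∀ x ∈ (∏ p ∈ S, I p) * ∏ p ∈ S', I p, w x = 1) → (∀ j, |θ j| * C ≤ 1) → w = 0)
    {K : Fin (n + 1) → ℕ} (hKpos : ∀ i, 0 < K i) (hK : ∀ i, 4 * Real.pi * C ≤ K i)
    {u u' : AddChar (Fin (n + 1) → 𝓞 k ⧸ J) ℂ} (hu : u ∈ smallChars J K)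
    (hu' : u' ∈ smallChars J K)
    (heq : combine (fun p => reduceHom (hJ p)) f + u =
      combine (fun p => reduceHom (hJ p)) f' + u') : f = f' := by
  obtain ⟨θ, hθ, hu⟩ := mem_smallChars.mp hu
  obtain ⟨θ', hθ', hu'⟩ := mem_smallChars.mp hu'
  have hpi := Real.pi_pos
  apply combine_reduceHom_injective hcop hJ
  set v := combine (fun p => reduceHom (hJ p)) f - combine (fun p => reduceHom (hJ p)) f' with hv
  have hvu : v = u' - u := by
    rw [hv, sub_eq_sub_iff_add_eq_add]
    exact heq.trans (add_comm _ _)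
  have hcoord : ∀ i, coordChar v i = 0 := by
    intro i
    refine htriv _ (fun j => θ' i j - θ i j) ?_ ?_ ?_
    · intro j
      have h1 := hu i j
      have h2 := hu' i j
      rw [coordChar_apply] at h1 h2 ⊢
      rw [hvu, AddChar.sub_apply, AddChar.map_neg_eq_inv, h1, h2, ← Complex.exp_neg,
        ← Complex.exp_add]
      congr 1
      push_cast
      ring
    · intro x hx
      rw [coordChar_apply, hv, AddChar.sub_apply, AddChar.map_neg_eq_inv]
      have hmem : ∀ T : Ideal (𝓞 k), x ∈ T → ∀ j, (Pi.single i x : Fin (n + 1) → 𝓞 k) j ∈ T := by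
        intro T hxT j
        by_cases hj : j = i
        · subst hj; simpa using hxT
        · simp [Pi.single_eq_of_ne hj]
      rw [combine_reduce_eq_one hJ hf (hmem _ (Ideal.mul_le_left hx)),
        combine_reduce_eq_one hJ hf' (hmem _ (Ideal.mul_le_right hx)), inv_one, mul_one]
    · intro j
      have hKi : (0 : ℝ) < K i := by exact_mod_cast hKpos i
      have h1 : |θ' i j - θ i j| ≤ 4 * Real.pi / K i := by
        have h2 := abs_le.mp (hθ i j)
        have h3 := abs_le.mp (hθ' i j)
        have h4 : 4 * Real.pi / K i = 2 * Real.pi / K i + 2 * Real.pi / K i := by ring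
        rw [abs_le]
        constructor <;> linarith
      rcases le_total 0 C with hC | hC
      · calc _ ≤ 4 * Real.pi / K i * C := by gcongr
          _ = 4 * Real.pi * C / K i := by ring
          _ ≤ 1 := by
              rw [div_le_one hKi]
              exact hK i
      · exact (mul_nonpos_of_nonneg_of_nonpos (abs_nonneg _) hC).trans zero_le_one
  have hv0 : v = 0 := by
    rw [AddChar.eq_zero_iff]
    intro z
    obtain ⟨y, rfl⟩ := reduce_surjective J z
    rw [apply_reduce_eq_prod_coordChar]
    simp [hcoord]
  exact sub_eq_zero.mp (hv.symm.trans hv0)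

variable (k n) in
/-- The large sieve for boxes in `(𝓞 k)^(n+1)` with pairwise coprime moduli. -/
theorem exists_forall_sum_prod_mul_card_le : ∃ C : ℝ, 0 < C ∧
    ∀ (ι : Type u) [Fintype ι] (I : ι → Ideal (𝓞 k)) [∀ p, Fintype (Fin (n + 1) → 𝓞 k ⧸ I p)]
      (Ω : ∀ p, Finset (Fin (n + 1) → 𝓞 k ⧸ I p)) (X : Finset (Fin (n + 1) → 𝓞 k))
      (R : Fin (n + 1) → ℝ) (Y : ℝ) (𝒮 : Finset (Finset ι)),
      (∀ p, I p ≠ ⊥) → Pairwise (Function.onFun IsCoprime I) →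
      (∀ p, (Ω p).card < Fintype.card (Fin (n + 1) → 𝓞 k ⧸ I p)) →
      (∀ x ∈ X, ∀ p, reduce k (I p) x ∉ Ω p) →
      (∀ i, 0 ≤ R i) → (∀ x ∈ X, ∀ i j, |((RingOfIntegers.basis k).repr (x i) j : ℝ)| ≤ R i) →
      1 ≤ Y →
      (∀ S ∈ 𝒮, (Ideal.absNorm (∏ p ∈ S, I p) : ℝ) ^ 2 ≤ Y ^ Module.finrank ℚ k) →
      (∑ S ∈ 𝒮, ∏ p ∈ S, ((Ω p).card : ℝ) /
          (Fintype.card (Fin (n + 1) → 𝓞 k ⧸ I p) - (Ω p).card)) * X.card ≤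
        C * ∏ i, (R i + Y) ^ Module.finrank ℚ k := by
  classical
  obtain ⟨C₁, hC₁, htriv⟩ := exists_forall_addChar_eq_zero k
  have hpi := Real.pi_pos
  set D := Module.finrank ℚ k with hDdef
  -- The first summand makes small characters nearly constant on the box of size `R`; the second
  -- makes their translates disjoint at scale `Y`.
  set C₂ : ℝ := 2 * Real.pi * (n + 1) * D + 4 * Real.pi * C₁ with hC₂
  have hC₂pos : 0 < C₂ := by positivity
  refine ⟨4 * ∏ i : Fin (n + 1), (C₂ + 2) ^ D, by positivity, ?_⟩
  intro ι _ I _ Ω X R Y 𝒮 hI hcop hΩ hX hR hbox hY h𝒮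
  have hIprod : ∀ S : Finset ι, ∏ p ∈ S, I p ≠ ⊥ := fun S =>
    Finset.prod_ne_zero_iff.mpr fun p _ => hI p
  obtain ⟨J, hJ0, hJle, hJinj⟩ := exists_ideal_le_injOn_reduce X (∏ p, I p) (hIprod _)
  have hJ : ∀ p, J ≤ I p := fun p =>
    hJle.trans (Ideal.le_of_dvd (Finset.dvd_prod_of_mem I (Finset.mem_univ p)))
  have := Ideal.finiteQuotientOfFreeOfNeBot J hJ0
  let := Fintype.ofFinite (𝓞 k ⧸ J)
  let K : Fin (n + 1) → ℕ := fun i => ⌈C₂ * (R i + Y)⌉₊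
  have hK : ∀ i, C₂ * (R i + Y) ≤ K i := fun i => Nat.le_ceil _
  have hKpos : ∀ i, 0 < K i := fun i => Nat.ceil_pos.mpr (by have := hR i; positivity)
  let X' := X.image (reduce k J)
  have hcardX : X'.card = X.card := Finset.card_image_of_injOn hJinj
  let F := 𝒮.biUnion fun S => supportedOn (R := fun p => Fin (n + 1) → 𝓞 k ⧸ I p) S
  have hlower : (∑ S ∈ 𝒮, ∏ p ∈ S, ((Ω p).card : ℝ) /
      (Fintype.card (Fin (n + 1) → 𝓞 k ⧸ I p) - (Ω p).card)) * (X'.card : ℝ) ^ 2 ≤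
      ∑ f ∈ F, ‖∑ x ∈ X', combine (fun p => reduceHom (hJ p)) f x‖ ^ 2 := by
    rw [Finset.sum_biUnion, Finset.sum_mul]
    · refine Finset.sum_le_sum fun S _ => ?_
      refine prod_mul_card_sq_le _ X' Ω hΩ ?_ S
      intro x hx p
      obtain ⟨y, hy, rfl⟩ := Finset.mem_image.mp hx
      rw [reduceHom_reduce]
      exact hX y hy p
    · intro S _ S' _ hne
      rw [Function.onFun, Finset.disjoint_left]
      intro f hf hf'
      refine hne (Finset.ext fun p => ?_)
      rw [← mem_supportedOn.mp hf p, mem_supportedOn.mp hf' p]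
  have hupper := card_mul_sum_norm_sq_le X' F (combine fun p => reduceHom (hJ p))
    (smallChars J K) ?_ ⟨0, zero_mem_smallChars J K⟩ ?_
  · have hcard : (Fintype.card (Fin (n + 1) → 𝓞 k ⧸ J) : ℝ) ≤
        (smallChars (n := n) J K).card * ∏ i, ((C₂ + 2) * (R i + Y)) ^ D := by
      calc (Fintype.card (Fin (n + 1) → 𝓞 k ⧸ J) : ℝ) ≤
            (smallChars (n := n) J K).card * ∏ i, ((K i : ℝ) + 1) ^ D := by
            exact_mod_cast card_le_card_smallChars_mul J K hKpos
        _ ≤ _ := by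
            gcongr with i
            -- Since `R i + Y ≥ 1`, both the rounding and the extra cell are absorbed into `C₂ + 2`.
            have h1 : (K i : ℝ) < C₂ * (R i + Y) + 1 :=
              Nat.ceil_lt_add_one (by have := hR i; positivity)
            nlinarith [hR i]
    have hUpos : (0 : ℝ) < (smallChars (n := n) J K).card := by
      exact_mod_cast Finset.card_pos.mpr ⟨0, zero_mem_smallChars J K⟩
    rw [hcardX] at hlower hupper
    rcases Nat.eq_zero_or_pos X.card with h0 | h0
    · rw [h0, Nat.cast_zero, mul_zero]
      have : ∀ i, 0 ≤ R i + Y := fun i => by have := hR i; positivity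
      have : 0 ≤ ∏ i, (R i + Y) ^ D := Finset.prod_nonneg fun i _ => pow_nonneg (this i) _
      positivity
    · have hXpos : (0 : ℝ) < X.card := by exact_mod_cast h0
      refine le_of_mul_le_mul_left ?_ (mul_pos hUpos hXpos)
      calc _ = (smallChars (n := n) J K).card * ((∑ S ∈ 𝒮, ∏ p ∈ S, ((Ω p).card : ℝ) /
              (Fintype.card (Fin (n + 1) → 𝓞 k ⧸ I p) - (Ω p).card)) * (X.card : ℝ) ^ 2) := by
            ring
        _ ≤ 4 * Fintype.card (Fin (n + 1) → 𝓞 k ⧸ J) * X.card :=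
            (mul_le_mul_of_nonneg_left hlower hUpos.le).trans hupper
        _ ≤ 4 * ((smallChars (n := n) J K).card * ∏ i, ((C₂ + 2) * (R i + Y)) ^ D) * X.card := by
            gcongr
        _ = _ := by
            simp only [mul_pow, Finset.prod_mul_distrib]
            ring
  · intro u hu x hx
    obtain ⟨y, hy, rfl⟩ := Finset.mem_image.mp hx
    refine half_le_re_of_mem_smallChars hu (fun i => ?_) hKpos (hbox y hy)
    refine le_trans ?_ (hK i)
    have := hR i
    have h1 : 0 ≤ 4 * Real.pi * C₁ * R i := by positivity
    have h2 : 0 ≤ C₂ * Y := by positivity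
    rw [hC₂] at h2 ⊢
    linarith
  · intro f hf f' hf' u hu u' hu' heq
    obtain ⟨S, hS, hf⟩ := Finset.mem_biUnion.mp hf
    obtain ⟨S', hS', hf'⟩ := Finset.mem_biUnion.mp hf'
    refine eq_of_combine_add_eq (C := C₁ * Y) (K := K) hcop hJ hf hf' (fun w θ hw hwI hθ => ?_)
      hKpos (fun i => ?_) hu hu' heq
    · refine htriv ((∏ p ∈ S, I p) * ∏ p ∈ S', I p) Y (mul_ne_zero (hIprod S) (hIprod S'))
        (by positivity) ?_ w θ hw hwI hθ
      rw [map_mul, Nat.cast_mul]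
      have a1 := h𝒮 S hS
      have a2 := h𝒮 S' hS'
      -- The product of the two norms is at most the mean of their squares, hence at most `Y ^ D`.
      nlinarith [sq_nonneg ((Ideal.absNorm (∏ p ∈ S, I p) : ℝ) -
        (Ideal.absNorm (∏ p ∈ S', I p) : ℝ))]
    · refine le_trans ?_ (hK i)
      have := hR i
      have h2 : 0 ≤ C₂ * R i := by positivity
      have h3 : 0 ≤ 2 * Real.pi * (n + 1) * D * Y := by positivity
      rw [hC₂] at h2 ⊢
      linarith

end

/-! ### Units and representatives of orbits in a box -/

section

variable (k : Type*) [Field k] [NumberField k]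

open Units Units.dirichletUnitTheorem in
/-- Any vector on the trace-zero hyperplane is within bounded distance of the unit lattice. -/
theorem exists_unit_abs_log_add_le : ∃ C : ℝ, 0 ≤ C ∧ ∀ z : InfinitePlace k → ℝ, ∑ w, z w = 0 →
    ∃ u : (𝓞 k)ˣ, ∀ w : InfinitePlace k, |w.mult * Real.log (w ((u : 𝓞 k) : k)) + z w| ≤ C := by
  classical
  let b := (basisUnitLattice k).ofZLatticeBasis ℝ (unitLattice k)
  have hb : ∀ m, ‖ZSpan.fract b m‖ ≤ ∑ i, ‖b i‖ := ZSpan.norm_fract_le b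
  set C₀ := ∑ i, ‖b i‖
  have hC₀ : 0 ≤ C₀ := by positivity
  -- Away from `w₀` the error is a coordinate of a point of the fundamental domain, at most `C₀`. At
  -- `w₀` it is minus the sum of the others, by the product formula for units and `hz`.
  refine ⟨(Fintype.card (InfinitePlace k) + 1) * C₀, by positivity, fun z hz => ?_⟩
  let z' : logSpace k := fun w => z w
  have hmem : (ZSpan.floor b z' : logSpace k) ∈ unitLattice k := by
    have h := (ZSpan.floor b z').2
    exact (Module.Basis.ofZLatticeBasis_span ℝ (unitLattice k) (basisUnitLattice k)).le h
  obtain ⟨u, -, hu⟩ := (Submodule.neg_mem_iff _).mpr hmem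
  have hu' : ∀ w : {w : InfinitePlace k // w ≠ w₀},
      (w.1.mult : ℝ) * Real.log (w.1 (((Additive.toMul u : (𝓞 k)ˣ) : 𝓞 k) : k)) + z w =
        ZSpan.fract b z' w := by
    intro w
    have h1 := congrFun hu w
    have h2 : (logEmbedding k) u w = _ := logEmbedding_component (Additive.toMul u) w
    change (logEmbedding k) u w = _ at h1
    rw [← h2, h1, ZSpan.fract_apply, Pi.sub_apply, Pi.neg_apply]
    change -_ + z' w = _
    ring
  have hle : ∀ w : {w : InfinitePlace k // w ≠ w₀}, |ZSpan.fract b z' w| ≤ C₀ := fun w =>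
    (norm_le_pi_norm (ZSpan.fract b z') w).trans (hb z')
  refine ⟨Additive.toMul u, fun w => ?_⟩
  by_cases hw : w = w₀
  · subst hw
    have h1 := sum_logEmbedding_component (Additive.toMul u)
    have h2 : ∑ w : {w : InfinitePlace k // w ≠ w₀}, z w + z w₀ = 0 := by
      rw [← hz, ← Finset.sum_erase_add _ _ (Finset.mem_univ (w₀ : InfinitePlace k))]
      congr 1
      exact (Finset.sum_subtype (Finset.univ.erase (w₀ : InfinitePlace k)) (by simp) z).symm
    have h3 : (w₀ : InfinitePlace k).mult * Real.log ((w₀ : InfinitePlace k)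
        (((Additive.toMul u : (𝓞 k)ˣ) : 𝓞 k) : k)) + z w₀ =
        -∑ w : {w : InfinitePlace k // w ≠ w₀}, ZSpan.fract b z' w := by
      rw [← Finset.sum_congr rfl fun w _ => hu' w, Finset.sum_add_distrib]
      simp only [logEmbedding_component] at h1
      linarith
    rw [h3, abs_neg]
    calc _ ≤ ∑ w : {w : InfinitePlace k // w ≠ w₀}, |ZSpan.fract b z' w| :=
          Finset.abs_sum_le_sum_abs _ _
      _ ≤ ∑ w : {w : InfinitePlace k // w ≠ w₀}, C₀ := Finset.sum_le_sum fun w _ => hle w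
      _ = Fintype.card {w : InfinitePlace k // w ≠ w₀} * C₀ := by simp
      _ ≤ _ := by
          gcongr
          have : Fintype.card {w : InfinitePlace k // w ≠ w₀} ≤ Fintype.card (InfinitePlace k) :=
            Fintype.card_subtype_le _
          have h : (Fintype.card {w : InfinitePlace k // w ≠ w₀} : ℝ) ≤
            Fintype.card (InfinitePlace k) := by exact_mod_cast this
          linarith
  · rw [hu' ⟨w, hw⟩]
    refine (hle ⟨w, hw⟩).trans ?_
    have : (0 : ℝ) ≤ Fintype.card (InfinitePlace k) := Nat.cast_nonneg _
    nlinarith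

/-- The coordinates of an algebraic integer are bounded in terms of its absolute values. -/
theorem exists_abs_repr_le : ∃ C : ℝ, 0 ≤ C ∧ ∀ (α : 𝓞 k) (t : ℝ),
    (∀ w : InfinitePlace k, w (α : k) ≤ t) →
      ∀ j, |((RingOfIntegers.basis k).repr α j : ℝ)| ≤ C * t := by
  classical
  obtain ⟨C, h1⟩ : ∃ C : ℝ, ∀ (α : 𝓞 k) (i : k →+* ℂ),
      ‖(((((integralBasis k).reindex (equivReindex k).symm).repr (α : k)) i : ℚ) : ℂ)‖ ≤
        C * house (algebraMap (𝓞 k) k α) := ⟨_, house.basis_repr_norm_le_const_mul_house k⟩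
  refine ⟨|C|, abs_nonneg C, fun α t ht j => ?_⟩
  have h2 := h1 α ((equivReindex k).symm j)
  have h3 : house (α : k) ≤ t := by
    have ht0 : 0 ≤ t := (apply_nonneg _ _).trans (ht (Classical.arbitrary _))
    rw [house, canonicalEmbedding.norm_le_iff]
    intro φ
    exact ht (InfinitePlace.mk φ)
  have h4 : |((RingOfIntegers.basis k).repr α j : ℝ)| ≤ C * house (α : k) := by
    refine le_trans (le_of_eq ?_) h2
    rw [Module.Basis.repr_reindex_apply]
    simp [integralBasis_repr_apply]
  calc _ ≤ C * house (α : k) := h4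
    _ ≤ |C| * house (α : k) := by gcongr; exacts [house_nonneg _, le_abs_self C]
    _ ≤ |C| * t := by gcongr

variable {n : ℕ}

/-- Every orbit has a representative in a box whose shape is governed by the weighted height. -/
theorem exists_rel_abs_repr_le (a : Fin (n + 1) → ℕ+) : ∃ C : ℝ, 0 ≤ C ∧
    ∀ (x : Fin (n + 1) → 𝓞 k) (T : ℝ), 0 < T → heightInfty k a x ≤ T →
      ∃ y, (unitSetoid k a).r x y ∧ ∀ i j, |((RingOfIntegers.basis k).repr (y i) j : ℝ)| ≤
        C * T ^ ((a i : ℝ) / Module.finrank ℚ k) := by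
  obtain ⟨C₀, hC₀, hunit⟩ := exists_unit_abs_log_add_le k
  obtain ⟨C₁, hC₁, hrepr⟩ := exists_abs_repr_le k
  -- The sum of the weights serves as a uniform bound for each `a i`.
  refine ⟨C₁ * Real.exp (C₀ * ∑ i, (a i : ℝ)), by positivity, fun x T hT hxT => ?_⟩
  by_cases hx : x = 0
  · refine ⟨x, (unitSetoid k a).refl x, fun i j => ?_⟩
    subst hx
    simp only [Pi.zero_apply, map_zero, Finsupp.coe_zero, Int.cast_zero, abs_zero]
    positivity
  obtain ⟨i₀, hi₀⟩ := Function.ne_iff.mp hx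
  set D : ℝ := (Module.finrank ℚ k : ℝ) with hD
  have hDpos : 0 < D := by rw [hD]; exact_mod_cast Module.finrank_pos
  let h : InfinitePlace k → ℝ := fun v => ⨆ i, (v (x i : k) ^ v.mult) ^ (1 / ((a i : ℕ) : ℝ))
  have hle : ∀ v i, (v (x i : k) ^ v.mult) ^ (1 / ((a i : ℕ) : ℝ)) ≤ h v := fun v i =>
    le_ciSup (f := fun i => (v (x i : k) ^ v.mult) ^ (1 / ((a i : ℕ) : ℝ)))
      (Set.finite_range _).bddAbove i
  have hpos : ∀ v, 0 < h v := by
    intro v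
    refine lt_of_lt_of_le ?_ (hle v i₀)
    have h0 : (x i₀ : k) ≠ 0 := by simpa using hi₀
    have : 0 < v (x i₀ : k) := InfinitePlace.pos_iff.mpr h0
    positivity
  set H := ∏ v, h v with hH
  have hHT : H ≤ T := hxT
  have hHpos : 0 < H := Finset.prod_pos fun v _ => hpos v
  -- The unit should balance the local heights, making each comparable to `H ^ (v.mult / D)`; the
  -- deviations sum to zero because the local degrees sum to `D`.
  obtain ⟨u, hu⟩ := hunit (fun v => Real.log (h v) - v.mult / D * Real.log H) (by
    rw [Finset.sum_sub_distrib, ← Finset.sum_mul, ← Finset.sum_div,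
      ← Real.log_prod fun v _ => (hpos v).ne', ← hH, ← Nat.cast_sum, InfinitePlace.sum_mult_eq,
      div_self hDpos.ne', one_mul, sub_self])
  refine ⟨fun i => (u : 𝓞 k) ^ (a i : ℕ) * x i, ⟨u, fun i => rfl⟩, fun i j => ?_⟩
  have hvu : ∀ v : InfinitePlace k, 0 < v ((u : 𝓞 k) : k) := fun v =>
    InfinitePlace.pos_iff.mpr (by simp)
  have hscaled : ∀ v : InfinitePlace k, v ((u : 𝓞 k) : k) ^ v.mult * h v ≤
      Real.exp C₀ * T ^ (v.mult / D) := by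
    intro v
    have h1 := (abs_le.mp (hu v)).2
    have h2 : v ((u : 𝓞 k) : k) ^ v.mult * h v ≤ Real.exp C₀ * H ^ (v.mult / D) := by
      rw [← Real.log_le_log_iff (by have := hvu v; have := hpos v; positivity) (by positivity),
        Real.log_mul (by have := hvu v; positivity) (hpos v).ne',
        Real.log_mul (Real.exp_pos _).ne' (by positivity), Real.log_exp, Real.log_pow,
        Real.log_rpow hHpos]
      linarith
    refine h2.trans ?_
    gcongr
  have hone : ∀ v : InfinitePlace k, 1 ≤ v.mult := fun v => InfinitePlace.mult_pos
  have hval : ∀ v : InfinitePlace k, v (((u : 𝓞 k) ^ (a i : ℕ) * x i : 𝓞 k) : k) ≤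
      Real.exp (C₀ * ∑ i, (a i : ℝ)) * T ^ ((a i : ℝ) / D) := by
    intro v
    have hxv : v (x i : k) ^ v.mult ≤ h v ^ (a i : ℕ) := by
      have h1 := hle v i
      have h2 : 0 ≤ v (x i : k) ^ v.mult := by positivity
      calc v (x i : k) ^ v.mult = ((v (x i : k) ^ v.mult) ^ (1 / ((a i : ℕ) : ℝ))) ^ (a i : ℕ) := by
            rw [one_div, Real.rpow_inv_natCast_pow h2 (a i).pos.ne']
        _ ≤ _ := by gcongr
    have hexp : Real.exp C₀ ^ (a i : ℕ) ≤ Real.exp (C₀ * ∑ i, (a i : ℝ)) ^ v.mult := by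
      rw [← Real.exp_nat_mul, ← Real.exp_nat_mul, Real.exp_le_exp]
      have h1 : (a i : ℝ) ≤ ∑ i, (a i : ℝ) :=
        Finset.single_le_sum (f := fun i => (a i : ℝ)) (fun _ _ => Nat.cast_nonneg _)
          (Finset.mem_univ i)
      have h2 : (1 : ℝ) ≤ v.mult := by exact_mod_cast hone v
      have h3 : 0 ≤ C₀ * ∑ i, (a i : ℝ) := by positivity
      nlinarith
    -- Comparing powers of exponent `v.mult` treats real and complex places at once.
    refine (pow_le_pow_iff_left₀ (apply_nonneg v _) (by positivity) (by have := hone v; omega :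
      v.mult ≠ 0)).mp ?_
    calc v (((u : 𝓞 k) ^ (a i : ℕ) * x i : 𝓞 k) : k) ^ v.mult
        = (v ((u : 𝓞 k) : k) ^ v.mult) ^ (a i : ℕ) * v (x i : k) ^ v.mult := by
          push_cast
          rw [map_mul, map_pow]
          ring
      _ ≤ (v ((u : 𝓞 k) : k) ^ v.mult) ^ (a i : ℕ) * h v ^ (a i : ℕ) := by gcongr
      _ = (v ((u : 𝓞 k) : k) ^ v.mult * h v) ^ (a i : ℕ) := by rw [mul_pow]
      _ ≤ (Real.exp C₀ * T ^ (v.mult / D)) ^ (a i : ℕ) := by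
          have := hvu v
          have := hpos v
          exact pow_le_pow_left₀ (by positivity) (hscaled v) _
      _ = Real.exp C₀ ^ (a i : ℕ) * T ^ ((a i : ℝ) / D * v.mult) := by
          rw [mul_pow, ← Real.rpow_mul_natCast hT.le]
          congr 2
          ring
      _ ≤ Real.exp (C₀ * ∑ i, (a i : ℝ)) ^ v.mult * T ^ ((a i : ℝ) / D * v.mult) := by gcongr
      _ = _ := by rw [mul_pow, ← Real.rpow_mul_natCast hT.le]
  calc _ ≤ C₁ * (Real.exp (C₀ * ∑ i, (a i : ℝ)) * T ^ ((a i : ℝ) / D)) := hrepr _ _ hval j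
    _ = _ := by ring

end

/-! ### The sieve sum as a finite sum over sets of primes -/

section

universe u

variable {k : Type u} [Field k] [NumberField k] {n : ℕ}

omit [NumberField k] in
theorem uniformMass_eq_ofReal (I : Ideal (𝓞 k)) [Fintype (Fin (n + 1) → 𝓞 k ⧸ I)]
    (S : Finset (Fin (n + 1) → 𝓞 k ⧸ I)) :
    uniformMass k I (S : Set (Fin (n + 1) → 𝓞 k ⧸ I)) =
      ENNReal.ofReal (S.card / Fintype.card (Fin (n + 1) → 𝓞 k ⧸ I)) := by
  have hpos : (0 : ℝ) < Fintype.card (Fin (n + 1) → 𝓞 k ⧸ I) := by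
    exact_mod_cast Fintype.card_pos
  rw [uniformMass, Set.encard_coe_eq_coe_finsetCard, Nat.card_eq_fintype_card,
    ENNReal.ofReal_div_of_pos hpos, ENNReal.ofReal_natCast, ENNReal.ofReal_natCast]
  simp

-- Passes from the extended quotient to the real factor that the arithmetic half produces; `hS`
-- keeps the denominator nonzero.
omit [NumberField k] in
theorem uniformMass_div_one_sub (I : Ideal (𝓞 k)) [Fintype (Fin (n + 1) → 𝓞 k ⧸ I)]
    (S : Finset (Fin (n + 1) → 𝓞 k ⧸ I)) (hS : S.card < Fintype.card (Fin (n + 1) → 𝓞 k ⧸ I)) :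
    uniformMass k I (S : Set (Fin (n + 1) → 𝓞 k ⧸ I)) /
        (1 - uniformMass k I (S : Set (Fin (n + 1) → 𝓞 k ⧸ I))) =
      ENNReal.ofReal (S.card / (Fintype.card (Fin (n + 1) → 𝓞 k ⧸ I) - S.card)) := by
  have hlt : (S.card : ℝ) < Fintype.card (Fin (n + 1) → 𝓞 k ⧸ I) := by exact_mod_cast hS
  have hpos : (0 : ℝ) < Fintype.card (Fin (n + 1) → 𝓞 k ⧸ I) := by
    exact_mod_cast Fintype.card_pos
  rw [uniformMass_eq_ofReal, ← ENNReal.ofReal_one, ← ENNReal.ofReal_sub _ (by positivity),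
    ← ENNReal.ofReal_div_of_pos (by rw [sub_pos, div_lt_one hpos]; exact hlt)]
  congr 1
  have : (Fintype.card (Fin (n + 1) → 𝓞 k ⧸ I) : ℝ) - S.card ≠ 0 := by linarith
  field_simp

theorem absNorm_le_of_dvd {I J : Ideal (𝓞 k)} (hJ : J ≠ ⊥) (h : I ∣ J) :
    Ideal.absNorm I ≤ Ideal.absNorm J :=
  Nat.le_of_dvd (Nat.pos_of_ne_zero (by rwa [Ne, Ideal.absNorm_eq_zero_iff]))
    (map_dvd Ideal.absNorm h)

theorem finite_setOf_absNorm_le_real (Q : ℝ) :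
    {q : Ideal (𝓞 k) | (Ideal.absNorm q : ℝ) ≤ Q}.Finite := by
  refine (Ideal.finite_setOfPred_absNorm_le (S := 𝓞 k) ⌊Q⌋₊).subset fun q hq => ?_
  exact Nat.le_floor hq

theorem finite_setOf_absNorm_asIdeal_le (Q : ℝ) :
    {p : HeightOneSpectrum (𝓞 k) | (Ideal.absNorm p.asIdeal : ℝ) ≤ Q}.Finite :=
  (finite_setOf_absNorm_le_real Q).preimage
    (fun _ _ _ _ h => HeightOneSpectrum.ext h)

/-- Squarefree ideals with the same prime divisors are equal. -/
theorem eq_of_squarefree_of_forall_dvd_iff {q q' : Ideal (𝓞 k)} (hq : Squarefree q)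
    (hq' : Squarefree q')
    (h : ∀ p : HeightOneSpectrum (𝓞 k), p.asIdeal ∣ q ↔ p.asIdeal ∣ q') : q = q' := by
  have h0 : q ≠ 0 := hq.ne_zero
  have h0' : q' ≠ 0 := hq'.ne_zero
  have key : UniqueFactorizationMonoid.normalizedFactors q =
      UniqueFactorizationMonoid.normalizedFactors q' := by
    rw [Multiset.Nodup.ext
      ((UniqueFactorizationMonoid.squarefree_iff_nodup_normalizedFactors h0).mp hq)
      ((UniqueFactorizationMonoid.squarefree_iff_nodup_normalizedFactors h0').mp hq')]
    intro p
    rw [Ideal.mem_normalizedFactors_iff h0, Ideal.mem_normalizedFactors_iff h0']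
    refine and_congr_right fun hp => ?_
    by_cases hp0 : p = ⊥
    · subst hp0
      simp only [le_bot_iff]
      exact ⟨fun h => absurd h h0, fun h => absurd h h0'⟩
    · simpa only [Ideal.dvd_iff_le] using h ⟨p, hp, hp0⟩
  have h1 := UniqueFactorizationMonoid.prod_normalizedFactors h0
  rw [key] at h1
  exact associated_iff_eq.mp (h1.symm.trans (UniqueFactorizationMonoid.prod_normalizedFactors h0'))

open Classical in
/-- The primes of a finite set that divide an ideal. -/
noncomputable def primeDivisors (P : Finset (HeightOneSpectrum (𝓞 k))) (q : Ideal (𝓞 k)) :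
    Finset {p // p ∈ P} :=
  Finset.univ.filter fun p => p.1.asIdeal ∣ q

omit [NumberField k] in
theorem mem_primeDivisors {P : Finset (HeightOneSpectrum (𝓞 k))} {q : Ideal (𝓞 k)}
    {p : {p // p ∈ P}} : p ∈ primeDivisors P q ↔ p.1.asIdeal ∣ q := by
  simp [primeDivisors]

/-- Distinct primes are coprime, so the product of those dividing `q` divides `q`; the norm is
multiplicative. -/
theorem absNorm_prod_primeDivisors_pow_le (P : Finset (HeightOneSpectrum (𝓞 k)))
    {q : Ideal (𝓞 k)} (hq : q ≠ ⊥) (m : ℕ) :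
    Ideal.absNorm (∏ p ∈ primeDivisors P q, p.1.asIdeal ^ m) ≤ Ideal.absNorm q ^ m := by
  rw [Finset.prod_pow, map_pow]
  refine Nat.pow_le_pow_left (absNorm_le_of_dvd hq ?_) m
  refine Finset.prod_dvd_of_coprime ?_ fun p hp => mem_primeDivisors.mp hp
  intro p _ p' _ hne
  exact HeightOneSpectrum.isCoprime_of_ne _ _ fun h => hne (Subtype.ext h)

theorem moebius_natAbs_sq (q : Ideal (𝓞 k)) [Decidable (Squarefree q)] :
    (moebius k q).natAbs ^ 2 = if Squarefree q then 1 else 0 := by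
  unfold moebius
  by_cases h : Squarefree q <;> simp [h, Int.natAbs_pow]

/-- The sieve sum is a finite sum over sets of primes of bounded norm. -/
theorem exists_sieveSum_eq (Q : ℝ) (m : ℕ) (P : Finset (HeightOneSpectrum (𝓞 k)))
    (hP : ∀ p, p ∈ P ↔ (Ideal.absNorm p.asIdeal : ℝ) ≤ Q)
    [∀ p : {p // p ∈ P}, Fintype (Fin (n + 1) → 𝓞 k ⧸ p.1.asIdeal ^ m)]
    (Ω : ∀ p : HeightOneSpectrum (𝓞 k), Set (Fin (n + 1) → 𝓞 k ⧸ p.asIdeal ^ m))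
    (Ω' : ∀ p : {p // p ∈ P}, Finset (Fin (n + 1) → 𝓞 k ⧸ p.1.asIdeal ^ m))
    (hΩ' : ∀ p, (Ω' p : Set (Fin (n + 1) → 𝓞 k ⧸ p.1.asIdeal ^ m)) = Ω p.1)
    (hcard : ∀ p, (Ω' p).card < Fintype.card (Fin (n + 1) → 𝓞 k ⧸ p.1.asIdeal ^ m)) :
    ∃ 𝒮 : Finset (Finset {p // p ∈ P}),
      (∀ S ∈ 𝒮, (Ideal.absNorm (∏ p ∈ S, p.1.asIdeal ^ m) : ℝ) ≤ Q ^ m) ∧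
      sieveSum k m Ω Q = ENNReal.ofReal (∑ S ∈ 𝒮, ∏ p ∈ S, ((Ω' p).card : ℝ) /
        (Fintype.card (Fin (n + 1) → 𝓞 k ⧸ p.1.asIdeal ^ m) - (Ω' p).card)) := by
  classical
  set g : {p // p ∈ P} → ℝ := fun p => ((Ω' p).card : ℝ) /
    (Fintype.card (Fin (n + 1) → 𝓞 k ⧸ p.1.asIdeal ^ m) - (Ω' p).card) with hg
  have hg0 : ∀ p, 0 ≤ g p := fun p =>
    div_nonneg (Nat.cast_nonneg _) (sub_nonneg.mpr (by exact_mod_cast (hcard p).le))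
  have hfin : {q : Ideal (𝓞 k) | q ≠ ⊥ ∧ (Ideal.absNorm q : ℝ) ≤ Q}.Finite :=
    (finite_setOf_absNorm_le_real Q).subset fun q hq => hq.2
  let : Fintype {q : Ideal (𝓞 k) // q ≠ ⊥ ∧ (Ideal.absNorm q : ℝ) ≤ Q} := hfin.fintype
  let 𝒬 : Finset {q : Ideal (𝓞 k) // q ≠ ⊥ ∧ (Ideal.absNorm q : ℝ) ≤ Q} :=
    Finset.univ.filter fun q => Squarefree q.1
  have hinj : Set.InjOn (fun q : {q : Ideal (𝓞 k) // q ≠ ⊥ ∧ (Ideal.absNorm q : ℝ) ≤ Q} =>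
      primeDivisors P q.1) 𝒬 := by
    intro q hq q' hq' h
    have hsq := (Finset.mem_filter.mp hq).2
    have hsq' := (Finset.mem_filter.mp hq').2
    have hdvd : ∀ r : {q : Ideal (𝓞 k) // q ≠ ⊥ ∧ (Ideal.absNorm q : ℝ) ≤ Q},
        ∀ p : HeightOneSpectrum (𝓞 k), p.asIdeal ∣ r.1 ↔
          ∃ hp : p ∈ P, (⟨p, hp⟩ : {p // p ∈ P}) ∈ primeDivisors P r.1 := by
      intro r p
      simp only [mem_primeDivisors, exists_prop, iff_and_self]
      intro hp
      rw [hP]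
      exact (Nat.cast_le.mpr (absNorm_le_of_dvd r.2.1 hp)).trans r.2.2
    refine Subtype.ext (eq_of_squarefree_of_forall_dvd_iff hsq hsq' fun p => ?_)
    rw [hdvd q, hdvd q']
    simp only at h
    rw [h]
  -- A squarefree ideal is determined by its prime divisors, all of which lie in `P` when its norm
  -- is at most `Q`, so reindexing loses nothing.
  refine ⟨𝒬.image fun q => primeDivisors P q.1, ?_, ?_⟩
  · intro S hS
    obtain ⟨q, _, rfl⟩ := Finset.mem_image.mp hS
    calc (Ideal.absNorm (∏ p ∈ primeDivisors P q.1, p.1.asIdeal ^ m) : ℝ)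
        ≤ (Ideal.absNorm q.1 : ℝ) ^ m := by
          exact_mod_cast absNorm_prod_primeDivisors_pow_le P q.2.1 m
      _ ≤ Q ^ m := by gcongr; exact q.2.2
  · rw [Finset.sum_image hinj,
      ENNReal.ofReal_sum_of_nonneg fun q _ => Finset.prod_nonneg fun p _ => hg0 p,
      sieveSum, tsum_fintype, Finset.sum_filter]
    refine Finset.sum_congr rfl fun q _ => ?_
    rw [moebius_natAbs_sq]
    split_ifs with hsq
    · rw [Nat.cast_one, one_mul, ENNReal.ofReal_prod_of_nonneg fun p _ => hg0 p]
      refine (finprod_cond_eq_prod_of_cond_iff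
        (fun p : HeightOneSpectrum (𝓞 k) => uniformMass k (p.asIdeal ^ m) (Ω p) /
          (1 - uniformMass k (p.asIdeal ^ m) (Ω p)))
        (t := (primeDivisors P q.1).map (Function.Embedding.subtype _)) ?_).trans ?_
      · intro p _
        simp only [Finset.mem_map, mem_primeDivisors, Function.Embedding.subtype_apply,
          Subtype.exists, exists_and_left, exists_prop, exists_eq_right_right, iff_self_and]
        intro hp
        rw [hP]
        exact (Nat.cast_le.mpr (absNorm_le_of_dvd q.2.1 hp)).trans q.2.2
      · rw [Finset.prod_map]
        refine Finset.prod_congr rfl fun p _ => ?_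
        rw [hg, ← uniformMass_div_one_sub _ _ (hcard p), hΩ' p]
        rfl
    · simp

/-- A set all of whose finite subsets have cardinality at most `E` has cardinality at most `E`. -/
theorem encard_le_of_forall_finset_card_le {α : Type*} {s : Set α} {E : ℝ≥0∞}
    (h : ∀ t : Finset α, (t : Set α) ⊆ s → (t.card : ℝ≥0∞) ≤ E) : (s.encard : ℝ≥0∞) ≤ E := by
  rcases s.finite_or_infinite with hs | hs
  · have := h hs.toFinset (by simp)
    rwa [hs.encard_eq_coe_toFinset_card, ENat.toENNReal_coe]
  · have hE : E = ⊤ := by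
      by_contra hE
      obtain ⟨N, hN⟩ := ENNReal.exists_nat_gt hE
      obtain ⟨t, ht, rfl⟩ := hs.exists_subset_card_eq N
      exact absurd (h t ht) (not_le.mpr hN)
    rw [hE]
    exact le_top

end

end LopsidedSieve

/-! ### The bound for sifted orbits -/

theorem theorem3p1 (k : Type*) [Field k] [NumberField k] (n : ℕ) (a : Fin (n + 1) → ℕ+)
    (c : ℝ) (hc : 0 < c) :
    ∃ C : ℝ, 0 < C ∧ ∀ (Q B : ℝ) (m : ℕ), 1 ≤ Q → 0 < B → 1 ≤ m →
      ∀ Ω : ∀ p : HeightOneSpectrum (𝓞 k), Set (Fin (n + 1) → 𝓞 k ⧸ p.asIdeal ^ m),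
        ((LopsidedSieve.siftedOrbits k a m Ω Q (c * B)).encard : ℝ≥0∞) ≤
          ENNReal.ofReal (C * ∏ i, (B ^ (a i : ℕ) + Q ^ (2 * m))) /
            LopsidedSieve.sieveSum k m Ω Q := by
  classical
  obtain ⟨C₁, hC₁, hrep⟩ := LopsidedSieve.exists_rel_abs_repr_le k a
  obtain ⟨C₂, hC₂, hsieve⟩ := LopsidedSieve.exists_forall_sum_prod_mul_card_le k n
  set D := Module.finrank ℚ k with hD
  have hD0 : D ≠ 0 := Module.finrank_pos.ne'
  have hDr : (D : ℝ) ≠ 0 := by exact_mod_cast hD0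
  -- The power of `2` comes from `(R + Y) ^ D ≤ 2 ^ (D - 1) * (R ^ D + Y ^ D)`, and the other factor
  -- from the size of the box at height `c * B`.
  refine ⟨C₂ * ∏ i, (2 ^ (D - 1) * (C₁ ^ D * c ^ (a i : ℕ) + 1)), by positivity, ?_⟩
  intro Q B m hQ hB _ Ω
  have hQ0 : 0 < Q := one_pos.trans_le hQ
  set P := (LopsidedSieve.finite_setOf_absNorm_asIdeal_le (k := k) Q).toFinset with hPdef
  have hP : ∀ p, p ∈ P ↔ (Ideal.absNorm p.asIdeal : ℝ) ≤ Q := by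
    intro p
    rw [hPdef, Set.Finite.mem_toFinset]
    rfl
  have hne : ∀ p : {p // p ∈ P}, p.1.asIdeal ^ m ≠ ⊥ := fun p => pow_ne_zero m p.1.ne_bot
  let : ∀ p : {p // p ∈ P}, Fintype (Fin (n + 1) → 𝓞 k ⧸ p.1.asIdeal ^ m) := fun p =>
    have := Ideal.finiteQuotientOfFreeOfNeBot _ (hne p)
    Fintype.ofFinite _
  let Ω' : ∀ p : {p // p ∈ P}, Finset (Fin (n + 1) → 𝓞 k ⧸ p.1.asIdeal ^ m) := fun p =>
    (Ω p.1).toFinset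
  have hΩ' : ∀ p, (Ω' p : Set (Fin (n + 1) → 𝓞 k ⧸ p.1.asIdeal ^ m)) = Ω p.1 := fun p =>
    Set.coe_toFinset _
  have havoid : ∀ ξ ∈ LopsidedSieve.siftedOrbits k a m Ω Q (c * B), ∀ x,
      Quotient.mk (LopsidedSieve.unitSetoid k a) x = ξ → ∀ p : {p // p ∈ P},
        LopsidedSieve.reduce k (p.1.asIdeal ^ m) x ∉ Ω' p := by
    intro ξ hξ x hx p
    rw [← Finset.mem_coe, hΩ']
    exact hξ.2 x hx p.1 ((hP p.1).mp p.2)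
  refine LopsidedSieve.encard_le_of_forall_finset_card_le fun t ht => ?_
  -- This split also settles the case of mass `1`: a surviving orbit shows that no `Ω p` with `p ∈
  -- P` is everything, so all factors of the sieve sum are finite.
  rcases t.eq_empty_or_nonempty with rfl | ⟨ξ₀, hξ₀⟩
  · simp
  have hcard : ∀ p, (Ω' p).card < Fintype.card (Fin (n + 1) → 𝓞 k ⧸ p.1.asIdeal ^ m) := by
    intro p
    rw [Finset.card_lt_iff_ne_univ]
    intro h
    obtain ⟨x, hx⟩ := Quotient.exists_rep ξ₀
    exact havoid ξ₀ (ht hξ₀) x hx p (h ▸ Finset.mem_univ _)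
  obtain ⟨𝒮, h𝒮, hsum⟩ := LopsidedSieve.exists_sieveSum_eq Q m P hP Ω Ω' hΩ' hcard
  have hrep' : ∀ ξ : {ξ // ξ ∈ t}, ∃ y, Quotient.mk (LopsidedSieve.unitSetoid k a) y = ξ.1 ∧
      ∀ i j, |((RingOfIntegers.basis k).repr (y i) j : ℝ)| ≤
        C₁ * (c * B) ^ ((a i : ℝ) / D) := by
    rintro ⟨ξ, hξ⟩
    obtain ⟨x, rfl⟩ := Quotient.exists_rep ξ
    obtain ⟨y, hxy, hy⟩ := hrep x (c * B) (by positivity) (ht hξ).1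
    exact ⟨y, (Quotient.sound hxy).symm, hy⟩
  choose y hymk hybox using hrep'
  have hyinj : Function.Injective y := by
    intro ξ ξ' h
    exact Subtype.ext (by rw [← hymk ξ, ← hymk ξ', h])
  -- Chosen so that `Y ^ D = Q ^ (2 * m)`, the square of the largest possible norm `Q ^ m` of a
  -- sieving modulus.
  set Y : ℝ := Q ^ ((2 * m : ℕ) / (D : ℝ)) with hY
  have hYD : Y ^ D = Q ^ (2 * m) := by
    rw [hY, ← Real.rpow_mul_natCast hQ0.le, div_mul_cancel₀ _ hDr, Real.rpow_natCast]
  have hY1 : 1 ≤ Y := Real.one_le_rpow hQ (by positivity)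
  have hRD : ∀ i, (C₁ * (c * B) ^ ((a i : ℝ) / D)) ^ D =
      C₁ ^ D * (c ^ (a i : ℕ) * B ^ (a i : ℕ)) := by
    intro i
    rw [mul_pow, ← Real.rpow_mul_natCast (by positivity), div_mul_cancel₀ _ hDr,
      Real.rpow_natCast, mul_pow]
  have key := hsieve {p // p ∈ P} (fun p => p.1.asIdeal ^ m) Ω' (Finset.univ.image y)
    (fun i => C₁ * (c * B) ^ ((a i : ℝ) / D)) Y 𝒮 hne
    (fun p p' hpp' => HeightOneSpectrum.isCoprime_pow_of_ne _ _
      (fun h => hpp' (Subtype.ext h)) _ _) hcard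
    (fun x hx p => by
      obtain ⟨ξ, _, rfl⟩ := Finset.mem_image.mp hx
      exact havoid ξ.1 (ht ξ.2) _ (hymk ξ) p)
    (fun i => by positivity)
    (fun x hx => by
      obtain ⟨ξ, _, rfl⟩ := Finset.mem_image.mp hx
      exact hybox ξ)
    hY1
    (fun S hS => by
      rw [hYD, mul_comm 2 m, pow_mul]
      exact pow_le_pow_left₀ (Nat.cast_nonneg _) (h𝒮 S hS) 2)
  rw [Finset.card_image_of_injective _ hyinj, Finset.card_univ, Fintype.card_coe] at key
  have hbound : C₂ * ∏ i, (C₁ * (c * B) ^ ((a i : ℝ) / D) + Y) ^ D ≤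
      (C₂ * ∏ i, (2 ^ (D - 1) * (C₁ ^ D * c ^ (a i : ℕ) + 1))) *
        ∏ i, (B ^ (a i : ℕ) + Q ^ (2 * m)) := by
    rw [mul_assoc, ← Finset.prod_mul_distrib]
    refine mul_le_mul_of_nonneg_left (Finset.prod_le_prod (fun i _ => by positivity) fun i _ => ?_)
      hC₂.le
    refine (add_pow_le (by positivity) (by positivity) D).trans ?_
    rw [hRD, hYD, mul_assoc]
    refine mul_le_mul_of_nonneg_left ?_ (by positivity)
    have h1 : 0 ≤ C₁ ^ D * c ^ (a i : ℕ) * Q ^ (2 * m) := by positivity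
    have h2 : 0 ≤ B ^ (a i : ℕ) := by positivity
    linarith
  -- The numerator is positive and finite, so clearing the denominator needs no information on the
  -- sieve sum.
  rw [ENNReal.le_div_iff_mul_le (Or.inr (by
    rw [Ne, ENNReal.ofReal_eq_zero, not_le]; positivity)) (Or.inr ENNReal.ofReal_ne_top), hsum,
    ← ENNReal.ofReal_natCast, ← ENNReal.ofReal_mul (Nat.cast_nonneg _)]
  refine ENNReal.ofReal_le_ofReal ?_
  rw [mul_comm]
  exact key.trans hbound
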